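/- Let $L,\tau,a,c_0>0$, $0<\alpha<\beta<\gamma<L$, and let $\kappa_1,\kappa_2\in\mathbb R$ satisfy hypothesis (H) $\kappa_1>0$, $\kappa_2\neq 0$ and $|\kappa_2|<\kappa_1$. Let $b=1$ on $(0,\beta)$ and $b=0$ on $(\beta,L)$; let $c=c_0$ on $(\alpha,\gamma)$ and $c=0$ on $(0,\alpha)\cup(\gamma,L)$. All functions are complex valued. Put $H^1_L(0,\beta)=\{\eta\in H^1(0,\beta):\eta(0)=0\}$, normed by $\|\eta_x\|_{L^2(0,\beta)}$, $\mathcal W=L^2((0,1);H^1_L(0,\beta))$, and let $\mathcal H=(H^1_0(0,L)\times L^2(0,L))^2\times\mathcal W$ be the Hilbert space with inner product $$(U,U^1)_{\mathcal H}=\int_0^L\left(a u_x\overline{u^1_x}+v\overline{v^1}+y_x\overline{y^1_x}+z\overline{z^1}\right)dx+\tau|\kappa_2|\int_0^\beta\int_0^1\eta_x\overline{\eta^1_x}\,d\rho\,dx$$ for $U=(u,v,y,z,\eta)$ and $U^1=(u^1,v^1,y^1,z^1,\eta^1)$. Write $S_b(u,v,\eta)=au_x+b\,(\kappa_1v_x+\kappa_2\eta_x(\cdot,1))$,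 and let $\mathcal A:D(\mathcal A)\subset\mathcal H\to\mathcal H$ be the unbounded linear operator $$\mathcal A(u,v,y,z,\eta)=\left(v,\ (S_b(u,v,\eta))_x-cz,\ z,\ y_{xx}+cv,\ -\tau^{-1}\eta_\rho\right)$$ whose domain $D(\mathcal A)$ consists of all $(u,v,y,z,\eta)\in\mathcal H$ such that $y\in H^2(0,L)\cap H^1_0(0,L)$, $v,z\in H^1_0(0,L)$, $(S_b(u,v,\eta))_x\in L^2(0,L)$, $\eta_\rho\in\mathcal W$, and $\eta(\cdot,0)=v$ on $(0,\beta)$. Then $i\mathbb R\subset\rho(\mathcal A)$: for every $\lambda\in\mathbb R$ the operator $i\lambda I-\mathcal A:D(\mathcal A)\to\mathcal H$ is bijective with bounded inverse. -/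

import Mathlib

namespace KelvinVoigt

open MeasureTheory Set
open scoped ContDiff

noncomputable section

/-! ### One-dimensional Sobolev notions on an open interval `(p, q)` -/

/-- Lebesgue measure on the open interval `(p, q)`. -/
abbrev leb (p q : ℝ) : Measure ℝ := volume.restrict (Ioo p q)

/-- `L²((p, q); E)`. -/
abbrev L2 (p q : ℝ) (E : Type) [NormedAddCommGroup E] : Type := Lp E 2 (leb p q)

/-- Test functions on `(p, q)`: smooth with compact support contained in `(p, q)`. -/
structure IsTest (p q : ℝ) (φ : ℝ → ℝ) : Prop where
  smooth : ContDiff ℝ ∞ φ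
  compact : HasCompactSupport φ
  supp : tsupport φ ⊆ Ioo p q

/-- `g` is the weak (distributional) derivative of `f` on `(p, q)`; the integrals are Bochner
integrals when the values are in a Banach space. -/
def IsWeakDeriv {E : Type} [NormedAddCommGroup E] [NormedSpace ℝ E] (p q : ℝ)
    (f g : ℝ → E) : Prop :=
  ∀ φ : ℝ → ℝ, IsTest p q φ →
    ∫ x in Ioo p q, deriv φ x • f x = - ∫ x in Ioo p q, φ x • g x

/-- `w` is a representative of `f` on `(p, q)` that is continuous up to the end points. The values
of a one-dimensional Sobolev function at points of `[p, q]` are those of such a representative. -/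
structure IsContRep {E : Type} [NormedAddCommGroup E] (p q : ℝ) (f w : ℝ → E) : Prop where
  cont : ContinuousOn w (Icc p q)
  ae_eq : f =ᵐ[leb p q] w

theorem L2.integrable {p q : ℝ} {E : Type} [NormedAddCommGroup E] (f : L2 p q E) :
    Integrable f (leb p q) :=
  (Lp.memLp f).integrable (by norm_num)

section WeakDeriv

variable {E : Type} [NormedAddCommGroup E] [NormedSpace ℝ E] {p q : ℝ}

theorem IsTest.deriv_cont {φ : ℝ → ℝ} (hφ : IsTest p q φ) : Continuous (deriv φ) :=
  hφ.smooth.continuous_deriv (by simp)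

theorem IsTest.integrable_smul {φ : ℝ → ℝ} (hφ : IsTest p q φ) {f : ℝ → E}
    (hf : Integrable f (leb p q)) : Integrable (fun x => φ x • f x) (leb p q) := by
  obtain ⟨C, hC⟩ := hφ.smooth.continuous.bounded_above_of_compact_support hφ.compact
  exact hf.bdd_smul C hφ.smooth.continuous.aestronglyMeasurable (Filter.Eventually.of_forall hC)

theorem IsTest.integrable_deriv_smul {φ : ℝ → ℝ} (hφ : IsTest p q φ) {f : ℝ → E}
    (hf : Integrable f (leb p q)) : Integrable (fun x => deriv φ x • f x) (leb p q) := by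
  obtain ⟨C, hC⟩ := hφ.deriv_cont.bounded_above_of_compact_support hφ.compact.deriv
  exact hf.bdd_smul C hφ.deriv_cont.aestronglyMeasurable (Filter.Eventually.of_forall hC)

theorem IsWeakDeriv.congr {f g f' g' : ℝ → E} (h : IsWeakDeriv p q f g)
    (hf : f' =ᵐ[leb p q] f) (hg : g' =ᵐ[leb p q] g) : IsWeakDeriv p q f' g' := by
  intro φ hφ
  have h1 : ∫ x in Ioo p q, deriv φ x • f' x = ∫ x in Ioo p q, deriv φ x • f x :=
    integral_congr_ae (by filter_upwards [hf] with x hx; rw [hx])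
  have h2 : ∫ x in Ioo p q, φ x • g' x = ∫ x in Ioo p q, φ x • g x :=
    integral_congr_ae (by filter_upwards [hg] with x hx; rw [hx])
  rw [h1, h2, h φ hφ]

theorem IsWeakDeriv.zero : IsWeakDeriv p q (fun _ => (0 : E)) (fun _ => 0) := by
  intro φ _; simp

theorem IsWeakDeriv.add {f g f' g' : ℝ → E} (h : IsWeakDeriv p q f g)
    (h' : IsWeakDeriv p q f' g') (hf : Integrable f (leb p q)) (hg : Integrable g (leb p q))
    (hf' : Integrable f' (leb p q)) (hg' : Integrable g' (leb p q)) :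
    IsWeakDeriv p q (fun x => f x + f' x) (fun x => g x + g' x) := by
  intro φ hφ
  simp only [smul_add]
  rw [integral_add (hφ.integrable_deriv_smul hf) (hφ.integrable_deriv_smul hf'),
    integral_add (hφ.integrable_smul hg) (hφ.integrable_smul hg'), h φ hφ, h' φ hφ, neg_add]

theorem IsWeakDeriv.const_smul {F : Type} [NormedAddCommGroup F] [NormedSpace ℂ F] {f g : ℝ → F}
    (c : ℂ) (h : IsWeakDeriv p q f g) :
    IsWeakDeriv p q (fun x => c • f x) (fun x => c • g x) := by
  intro φ hφ
  simp only [smul_comm _ c]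
  rw [integral_smul, integral_smul, h φ hφ, smul_neg]

/-- The weak derivative is unique. -/
theorem IsWeakDeriv.unique_zero [CompleteSpace E] {g : ℝ → E} (hg : Integrable g (leb p q))
    (h : IsWeakDeriv p q (fun _ => (0 : E)) g) : g =ᵐ[leb p q] 0 := by
  rw [Filter.EventuallyEq, ae_restrict_iff' measurableSet_Ioo]
  refine isOpen_Ioo.ae_eq_zero_of_integral_contDiff_smul_eq_zero
    (IntegrableOn.locallyIntegrableOn hg) ?_
  intro φ h1 h2 h3
  have := h φ ⟨h1, h2, h3⟩
  simp only [smul_zero, integral_zero, zero_eq_neg] at this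
  rw [← this, setIntegral_eq_integral_of_forall_compl_eq_zero]
  intro x hx
  rw [image_eq_zero_of_notMem_tsupport (fun hx' => hx (h3 hx')), zero_smul]

/-- A test function with zero mean is the derivative of a test function. -/
theorem IsTest.exists_primitive {φ : ℝ → ℝ} (hφ : IsTest p q φ)
    (h0 : ∫ x in Ioo p q, φ x = 0) : ∃ χ, IsTest p q χ ∧ deriv χ = φ := by
  by_cases hemp : tsupport φ = ∅
  · have : φ = 0 := by simpa [tsupport_eq_empty_iff] using hemp
    subst this
    exact ⟨0, ⟨contDiff_const, HasCompactSupport.zero, by simp [tsupport]⟩, by simp⟩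
  have hne : (tsupport φ).Nonempty := nonempty_iff_ne_empty.2 hemp
  obtain ⟨r, hr, hr'⟩ := hφ.compact.isCompact.exists_isLeast hne
  obtain ⟨s, hs, hs'⟩ := hφ.compact.isCompact.exists_isGreatest hne
  have hrq := hφ.supp hr
  have hsq := hφ.supp hs
  have hzl : ∀ x, x < r → φ x = 0 := fun x hx =>
    image_eq_zero_of_notMem_tsupport (fun h => absurd (hr' h) (not_le.2 hx))
  have hzr : ∀ x, s < x → φ x = 0 := fun x hx =>
    image_eq_zero_of_notMem_tsupport (fun h => absurd (hs' h) (not_le.2 hx))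
  have hc := hφ.smooth.continuous
  have hd : ∀ x, HasDerivAt (fun x => ∫ t in p..x, φ t) (φ x) x := fun x =>
    intervalIntegral.integral_hasDerivAt_right (hc.intervalIntegrable _ _)
      hc.stronglyMeasurable.stronglyMeasurableAtFilter hc.continuousAt
  have hderiv : deriv (fun x => ∫ t in p..x, φ t) = φ := funext fun x => (hd x).deriv
  have hpq : p ≤ q := (hrq.1.trans hrq.2).le
  have htot : ∫ t in p..q, φ t = 0 := by
    rw [intervalIntegral.integral_of_le hpq, integral_Ioc_eq_integral_Ioo, h0]
  have hout : ∀ x, x ∉ Icc r s → ∫ t in p..x, φ t = 0 := by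
    intro x hx
    by_cases hxr : x < r
    · refine intervalIntegral.integral_zero_ae (Filter.Eventually.of_forall fun t ht => hzl t ?_)
      rcases mem_uIoc.1 ht with h | h
      · exact h.2.trans_lt hxr
      · exact h.2.trans_lt hrq.1
    · have hxs : s < x := by
        by_contra hcon
        exact hx ⟨not_lt.1 hxr, not_lt.1 hcon⟩
      have : ∫ t in x..q, φ t = 0 := by
        refine intervalIntegral.integral_zero_ae (Filter.Eventually.of_forall fun t ht => hzr t ?_)
        rcases mem_uIoc.1 ht with h | h
        · exact hxs.trans h.1
        · exact hsq.2.trans h.1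
      rw [← intervalIntegral.integral_add_adjacent_intervals (hc.intervalIntegrable p x)
        (hc.intervalIntegrable x q), this, add_zero] at htot
      exact htot
  have hsub : tsupport (fun x => ∫ t in p..x, φ t) ⊆ Icc r s :=
    closure_minimal (fun x hx => by_contra fun h => hx (hout x h)) isClosed_Icc
  refine ⟨fun x => ∫ t in p..x, φ t, ⟨?_, ?_, ?_⟩, hderiv⟩
  · rw [contDiff_infty_iff_deriv, hderiv]
    exact ⟨fun x => (hd x).differentiableAt, hφ.smooth⟩
  · exact HasCompactSupport.of_support_subset_isCompact isCompact_Icc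
      ((subset_tsupport _).trans hsub)
  · exact hsub.trans fun x hx => ⟨hrq.1.trans_le hx.1, hx.2.trans_lt hsq.2⟩

theorem exists_test (hpq : p < q) : ∃ ψ, IsTest p q ψ ∧ ∫ x in Ioo p q, ψ x = 1 := by
  let b : ContDiffBump ((p + q) / 2) :=
    ⟨(q - p) / 8, (q - p) / 4, by linarith, by linarith⟩
  have hsupp : tsupport (b.normed volume) ⊆ Ioo p q := by
    rw [b.tsupport_normed_eq]
    intro x hx
    rw [Metric.mem_closedBall, Real.dist_eq, abs_le] at hx
    have h1 : b.rOut = (q - p) / 4 := rfl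
    rw [h1] at hx
    constructor <;> linarith [hx.1, hx.2]
  refine ⟨b.normed volume, ⟨b.contDiff_normed, b.hasCompactSupport_normed, hsupp⟩, ?_⟩
  rw [setIntegral_eq_integral_of_forall_compl_eq_zero, b.integral_normed]
  exact fun x hx => image_eq_zero_of_notMem_tsupport fun h => hx (hsupp h)

/-- A function with zero weak derivative is constant. -/
theorem IsWeakDeriv.ae_const [CompleteSpace E] {f : ℝ → E} (hf : Integrable f (leb p q))
    (h : IsWeakDeriv p q f (fun _ => 0)) : ∃ c : E, f =ᵐ[leb p q] fun _ => c := by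
  rcases le_or_gt q p with hqp | hpq
  · exact ⟨0, by simp [leb, Ioo_eq_empty (not_lt.2 hqp), Filter.EventuallyEq]⟩
  obtain ⟨ψ, hψ, hψ1⟩ := exists_test hpq
  refine ⟨∫ x in Ioo p q, ψ x • f x, ?_⟩
  set c := ∫ x in Ioo p q, ψ x • f x with hcdef
  have hint : ∀ φ, IsTest p q φ → Integrable φ (leb p q) := fun φ hφ =>
    (hφ.smooth.continuous.integrable_of_hasCompactSupport hφ.compact).restrict
  have key : (fun x => f x - c) =ᵐ[leb p q] 0 := by
    refine IsWeakDeriv.unique_zero (hf.sub (integrable_const c)) ?_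
    intro φ hφ
    set m := ∫ x in Ioo p q, φ x with hm
    have hφ' : IsTest p q (fun x => φ x - m * ψ x) := by
      refine ⟨hφ.smooth.sub (contDiff_const.mul hψ.smooth), hφ.compact.sub hψ.compact.mul_left, ?_⟩
      refine (tsupport_sub _ _).trans (union_subset hφ.supp ?_)
      exact (tsupport_mul_subset_right).trans hψ.supp
    have h0 : ∫ x in Ioo p q, (φ x - m * ψ x) = 0 := by
      rw [integral_sub (hint φ hφ) ((hint ψ hψ).const_mul m), integral_const_mul, hψ1]
      simp [hm]
    obtain ⟨χ, hχ, hχd⟩ := hφ'.exists_primitive h0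
    have := h χ hχ
    rw [hχd] at this
    simp only [smul_zero, integral_zero, neg_zero, sub_smul, mul_smul] at this
    have hψm : Integrable (fun x => m • ψ x • f x) (leb p q) := (hψ.integrable_smul hf).smul m
    rw [integral_sub (hφ.integrable_smul hf) hψm, integral_smul,
      ← hcdef, sub_eq_zero] at this
    simp only [smul_zero, integral_zero, smul_sub, zero_eq_neg]
    rw [integral_sub (hφ.integrable_smul hf) ((hint φ hφ).smul_const c), this,
      integral_smul_const, ← hm, sub_self]
  filter_upwards [key] with x hx
  exact sub_eq_zero.1 hx

end WeakDeriv

/-! ### The spaces `H¹₀(p, q)` and `H¹_L(p, q)` -/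

/-- The functions of `H¹(p, q)` that vanish at the left end point `p` and at the points of `Z`.
A function `u` is stored as the pair `(u, u')` in `L² × L²`, with `u'` its weak derivative. -/
def h1VanSub (p q : ℝ) (Z : Set ℝ) : Submodule ℂ (L2 p q ℂ × L2 p q ℂ) where
  carrier := {f | IsWeakDeriv p q f.1 f.2 ∧
    ∃ w, IsContRep p q f.1 w ∧ ∀ x ∈ insert p Z, w x = 0}
  zero_mem' := by
    refine ⟨IsWeakDeriv.zero.congr (Lp.coeFn_zero _ _ _) (Lp.coeFn_zero _ _ _),
      fun _ => 0, ⟨continuousOn_const, Lp.coeFn_zero _ _ _⟩, fun _ _ => rfl⟩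
  add_mem' := by
    rintro f g ⟨hf, w, hw, hw0⟩ ⟨hg, w', hw', hw0'⟩
    refine ⟨(hf.add hg f.1.integrable f.2.integrable g.1.integrable g.2.integrable).congr
      (Lp.coeFn_add _ _) (Lp.coeFn_add _ _), fun x => w x + w' x,
      ⟨hw.cont.add hw'.cont, ?_⟩, fun x hx => by simp [hw0 x hx, hw0' x hx]⟩
    exact (Lp.coeFn_add _ _).trans (hw.ae_eq.add hw'.ae_eq)
  smul_mem' := by
    rintro c f ⟨hf, w, hw, hw0⟩
    refine ⟨(hf.const_smul c).congr (Lp.coeFn_smul _ _) (Lp.coeFn_smul _ _), fun x => c • w x,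
      ⟨hw.cont.const_smul c, ?_⟩, fun x hx => by simp [hw0 x hx]⟩
    exact (Lp.coeFn_smul _ _).trans (hw.ae_eq.const_smul c)

/-- The functions of `H¹(p, q)` that vanish at `p` and at the points of `Z`, with the inner product
`∫ f_x \overline{g_x} dx`. -/
def H1Van (p q : ℝ) (Z : Set ℝ) : Type := h1VanSub p q Z

/-- `H¹₀(p, q)`. -/
abbrev H1Zero (p q : ℝ) : Type := H1Van p q {q}

/-- `H¹_L(p, q)`: the functions of `H¹(p, q)` that vanish at the left end point. -/
abbrev H1Left (p q : ℝ) : Type := H1Van p q ∅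

namespace H1Van

variable {p q : ℝ} {Z : Set ℝ}

instance : AddCommGroup (H1Van p q Z) := inferInstanceAs (AddCommGroup (h1VanSub p q Z))
instance : Module ℂ (H1Van p q Z) := inferInstanceAs (Module ℂ (h1VanSub p q Z))

/-- The underlying function of an element of `H¹`. -/
def fn : H1Van p q Z →ₗ[ℂ] L2 p q ℂ :=
  (LinearMap.fst ℂ _ _).comp (h1VanSub p q Z).subtype

/-- The weak derivative of an element of `H¹`. -/
def dx : H1Van p q Z →ₗ[ℂ] L2 p q ℂ :=
  (LinearMap.snd ℂ _ _).comp (h1VanSub p q Z).subtype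

theorem isWeakDeriv (f : H1Van p q Z) : IsWeakDeriv p q f.fn f.dx := f.2.1

theorem ext {f g : H1Van p q Z} (h : f.fn = g.fn) (h' : f.dx = g.dx) : f = g :=
  Subtype.ext (Prod.ext h h')

/-- An element of `H¹` that vanishes at `p` is determined by its derivative. -/
theorem dx_injective : Function.Injective (dx : H1Van p q Z →ₗ[ℂ] L2 p q ℂ) := by
  rw [injective_iff_map_eq_zero]
  intro f hf
  refine ext ?_ (by rw [hf, map_zero])
  rw [map_zero]
  obtain ⟨w, hw, hw0⟩ := f.2.2
  change IsContRep p q f.fn w at hw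
  have hp : w p = 0 := hw0 p (mem_insert _ _)
  rw [Lp.eq_zero_iff_ae_eq_zero]
  rcases le_or_gt q p with hqp | hpq
  · simp [leb, Ioo_eq_empty (not_lt.2 hqp), Filter.EventuallyEq]
  have hd : IsWeakDeriv p q f.fn (fun _ => (0 : ℂ)) :=
    f.isWeakDeriv.congr Filter.EventuallyEq.rfl (by rw [hf]; exact (Lp.coeFn_zero _ _ _).symm)
  obtain ⟨c, hc⟩ := hd.ae_const f.fn.integrable
  have hwc : w =ᵐ[leb p q] fun _ => c := hw.ae_eq.symm.trans hc
  have hEq : EqOn w (fun _ => c) (Ioo p q) :=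
    Measure.eqOn_open_of_ae_eq hwc isOpen_Ioo (hw.cont.mono Ioo_subset_Icc_self)
      continuousOn_const
  have hEq' : EqOn w (fun _ => c) (Icc p q) := by
    refine hEq.of_subset_closure hw.cont continuousOn_const Ioo_subset_Icc_self ?_
    rw [closure_Ioo hpq.ne]
  have hc0 : c = 0 := by rw [← hp]; exact (hEq' (left_mem_Icc.2 hpq.le)).symm
  rw [hc0] at hc
  exact hc

instance : NormedAddCommGroup (H1Van p q Z) :=
  NormedAddCommGroup.induced _ _ (dx : H1Van p q Z →ₗ[ℂ] L2 p q ℂ) dx_injective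

/-- The inner product `∫ f_x \overline{g_x} dx` (conjugate-linear in the first slot in Lean). -/
instance : InnerProductSpace ℂ (H1Van p q Z) where
  norm_smul_le c f := by
    change ‖dx (c • f)‖ ≤ ‖c‖ * ‖dx f‖
    rw [map_smul, norm_smul]
  inner f g := inner ℂ f.dx g.dx
  norm_sq_eq_re_inner f := norm_sq_eq_re_inner (𝕜 := ℂ) f.dx
  conj_inner_symm f g := inner_conj_symm f.dx g.dx
  add_left f g h := by
    change inner ℂ (dx (f + g)) h.dx = _
    rw [map_add, inner_add_left]
  smul_left f g c := by
    change inner ℂ (dx (c • f)) g.dx = _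
    rw [map_smul, inner_smul_left]

theorem norm_def (f : H1Van p q Z) : ‖f‖ = ‖f.dx‖ := rfl

theorem inner_def (f g : H1Van p q Z) : inner ℂ f g = inner ℂ f.dx g.dx := rfl

end H1Van

/-- Integration by parts against a primitive. -/
theorem integral_deriv_mul_primitive {p q : ℝ} (hpq : p < q) {g : ℝ → ℝ}
    (hg : IntervalIntegrable g volume p q) {φ : ℝ → ℝ} (hφ : IsTest p q φ) :
    ∫ x in Ioo p q, deriv φ x * ∫ t in p..x, g t = - ∫ x in Ioo p q, φ x * g x := by
  have hpφ : φ p = 0 := image_eq_zero_of_notMem_tsupport fun h => (lt_irrefl p (hφ.supp h).1)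
  have hqφ : φ q = 0 := image_eq_zero_of_notMem_tsupport fun h => (lt_irrefl q (hφ.supp h).2)
  have hG := hg.absolutelyContinuousOnInterval_intervalIntegral (c := p) left_mem_uIcc
  have hΦ : AbsolutelyContinuousOnInterval φ p q :=
    (hφ.smooth.of_le (by simp)).contDiffOn.absolutelyContinuousOnInterval
  have h := hΦ.integral_mul_deriv_eq_deriv_mul hG
  rw [hpφ, hqφ, zero_mul, zero_mul, sub_zero, zero_sub] at h
  have h2 : ∫ x in p..q, φ x * deriv (fun x => ∫ t in p..x, g t) x = ∫ x in p..q, φ x * g x := by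
    refine intervalIntegral.integral_congr_ae ?_
    filter_upwards [hg.ae_hasDerivAt_integral] with x hx hx'
    rw [(hx (uIoc_subset_uIcc hx') p left_mem_uIcc).deriv]
  rw [h2, intervalIntegral.integral_of_le hpq.le, intervalIntegral.integral_of_le hpq.le,
    integral_Ioc_eq_integral_Ioo, integral_Ioc_eq_integral_Ioo] at h
  rw [h, neg_neg]

/-- A primitive of an `L²` function has that function as its weak derivative. -/
theorem isWeakDeriv_primitive {p q : ℝ} (hpq : p < q) {g : ℝ → ℂ} (hg : Integrable g (leb p q)) :
    IsWeakDeriv p q (fun x => ∫ t in p..x, g t) g := by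
  have hgi : IntervalIntegrable g volume p q := by
    rwa [intervalIntegrable_iff_integrableOn_Ioo_of_le hpq.le]
  have hcont : ContinuousOn (fun x => ∫ t in p..x, g t) (Icc p q) := by
    have := intervalIntegral.continuousOn_primitive_interval' hgi left_mem_uIcc
    rwa [uIcc_of_le hpq.le] at this
  have hGi : Integrable (fun x => ∫ t in p..x, g t) (leb p q) :=
    (hcont.integrableOn_Icc).mono_set Ioo_subset_Icc_self
  have hsub : ∀ x ∈ Ioo p q, IntervalIntegrable g volume p x := fun x hx =>
    hgi.mono_set (by
      rw [uIcc_of_le hx.1.le, uIcc_of_le hpq.le]; exact Icc_subset_Icc_right hx.2.le)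
  intro φ hφ
  have i1 := hφ.integrable_deriv_smul hGi
  have i2 := hφ.integrable_smul hg
  have part : ∀ ℓ : ℂ →L[ℝ] ℝ, ℓ (∫ x in Ioo p q, deriv φ x • ∫ t in p..x, g t) =
      ℓ (- ∫ x in Ioo p q, φ x • g x) := by
    intro ℓ
    rw [map_neg, ← ℓ.integral_comp_comm i1, ← ℓ.integral_comp_comm i2]
    simp only [map_smul, smul_eq_mul]
    have hℓ : IntervalIntegrable (fun x => ℓ (g x)) volume p q := by
      rw [intervalIntegrable_iff_integrableOn_Ioo_of_le hpq.le]
      exact ℓ.integrable_comp hg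
    rw [← integral_deriv_mul_primitive hpq hℓ hφ]
    refine setIntegral_congr_fun measurableSet_Ioo fun x hx => ?_
    rw [ℓ.intervalIntegral_comp_comm (hsub x hx)]
  exact Complex.ext (part Complex.reCLM) (part Complex.imCLM)

/-- Every `L²` function is the derivative of an element of `H¹_L`. -/
theorem H1Left.dx_surjective {p q : ℝ} :
    Function.Surjective (H1Van.dx : H1Left p q →ₗ[ℂ] L2 p q ℂ) := by
  intro g
  rcases le_or_gt q p with hqp | hpq
  · refine ⟨0, Lp.ext ?_⟩
    simp [leb, Ioo_eq_empty (not_lt.2 hqp), Filter.EventuallyEq]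
  have hgi : IntervalIntegrable g volume p q := by
    rw [intervalIntegrable_iff_integrableOn_Ioo_of_le hpq.le]; exact g.integrable
  have hcont : ContinuousOn (fun x => ∫ t in p..x, g t) (Icc p q) := by
    have := intervalIntegral.continuousOn_primitive_interval' hgi left_mem_uIcc
    rwa [uIcc_of_le hpq.le] at this
  have hmem : MemLp (fun x => ∫ t in p..x, g t) 2 (leb p q) := by
    obtain ⟨C, hC⟩ := isCompact_Icc.exists_bound_of_continuousOn hcont
    refine MemLp.of_bound
      ((hcont.mono Ioo_subset_Icc_self).aestronglyMeasurable measurableSet_Ioo) C ?_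
    exact (ae_restrict_iff' measurableSet_Ioo).2
      (Filter.Eventually.of_forall fun x hx => hC x (Ioo_subset_Icc_self hx))
  refine ⟨⟨(hmem.toLp _, g), ?_, fun x => ∫ t in p..x, g t, ⟨hcont, hmem.coeFn_toLp⟩, ?_⟩, rfl⟩
  · exact (isWeakDeriv_primitive hpq g.integrable).congr hmem.coeFn_toLp Filter.EventuallyEq.rfl
  · simp

instance {p q : ℝ} : CompleteSpace (H1Left p q) := by
  let e : H1Left p q ≃ₗᵢ[ℂ] L2 p q ℂ :=
    LinearIsometryEquiv.ofSurjective ⟨H1Van.dx, fun _ => rfl⟩ H1Left.dx_surjective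
  exact (completeSpace_congr (e := e.toEquiv) e.isometry.isUniformEmbedding).2 inferInstance

theorem H1Van.fn_eq_zero {p q : ℝ} {Z : Set ℝ} {f : H1Van p q Z} (h : f.fn = 0) : f = 0 := by
  refine H1Van.ext (by rw [h, map_zero]) ?_
  rw [map_zero, Lp.eq_zero_iff_ae_eq_zero]
  refine IsWeakDeriv.unique_zero f.dx.integrable
    (f.isWeakDeriv.congr ?_ Filter.EventuallyEq.rfl)
  rw [h]
  exact (Lp.coeFn_zero _ _ _).symm

theorem IsContRep.eqOn_zero {E : Type} [NormedAddCommGroup E] {p q : ℝ} (hpq : p < q)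
    {f w : ℝ → E} (h : IsContRep p q f w) (hf : f =ᵐ[leb p q] 0) : EqOn w 0 (Icc p q) := by
  have hEq : EqOn w 0 (Ioo p q) :=
    Measure.eqOn_open_of_ae_eq (h.ae_eq.symm.trans hf) isOpen_Ioo
      (h.cont.mono Ioo_subset_Icc_self) continuousOn_const
  refine hEq.of_subset_closure h.cont continuousOn_const Ioo_subset_Icc_self ?_
  rw [closure_Ioo hpq.ne]

/-! ### The system -/

/-- The parameters of the system: `L, τ, a, κ₁, c₀ > 0`, `κ₂ ≠ 0` and `0 < α < β < γ < L`. -/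
structure Params where
  (L τ a κ₁ κ₂ α β γ c₀ : ℝ)
  hL : 0 < L
  hτ : 0 < τ
  ha : 0 < a
  hκ₁ : 0 < κ₁
  hκ₂ : κ₂ ≠ 0
  hα : 0 < α
  hαβ : α < β
  hβγ : β < γ
  hγL : γ < L
  hc₀ : 0 < c₀

namespace Params

/-- Hypothesis (H). -/
def HypH (P : Params) : Prop := 0 < P.κ₁ ∧ P.κ₂ ≠ 0 ∧ |P.κ₂| < P.κ₁

/-- The coefficient `b`, equal to `1` on `(0, β)` and to `0` elsewhere. -/
def b (P : Params) : ℝ → ℂ := (Ioo 0 P.β).indicator fun _ => 1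

/-- The coefficient `c`, equal to `c₀` on `(α, γ)` and to `0` elsewhere. -/
def c (P : Params) : ℝ → ℂ := (Ioo P.α P.γ).indicator fun _ => (P.c₀ : ℂ)

/-- The space `𝒲 = L²((0, 1); H¹_L(0, β))`. -/
abbrev W (P : Params) : Type := L2 0 1 (H1Left 0 P.β)

end Params

/-- The energy space `(H¹₀(0, L) × L²(0, L))² × 𝒲`. -/
def State (P : Params) : Type :=
  H1Zero 0 P.L × L2 0 P.L ℂ × H1Zero 0 P.L × L2 0 P.L ℂ × P.W

namespace State

variable {P : Params}

instance : AddCommGroup (State P) := inferInstanceAs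
  (AddCommGroup (H1Zero 0 P.L × L2 0 P.L ℂ × H1Zero 0 P.L × L2 0 P.L ℂ × P.W))
instance : Module ℂ (State P) := inferInstanceAs
  (Module ℂ (H1Zero 0 P.L × L2 0 P.L ℂ × H1Zero 0 P.L × L2 0 P.L ℂ × P.W))

/-- The component `u` of `(u, v, y, z, η)`. -/
def u (U : State P) : H1Zero 0 P.L := U.1
/-- The component `v` of `(u, v, y, z, η)`. -/
def v (U : State P) : L2 0 P.L ℂ := U.2.1
/-- The component `y` of `(u, v, y, z, η)`. -/
def y (U : State P) : H1Zero 0 P.L := U.2.2.1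
/-- The component `z` of `(u, v, y, z, η)`. -/
def z (U : State P) : L2 0 P.L ℂ := U.2.2.2.1
/-- The component `η` of `(u, v, y, z, η)`. -/
def η (U : State P) : P.W := U.2.2.2.2

theorem ext {U V : State P} (h1 : U.u = V.u) (h2 : U.v = V.v) (h3 : U.y = V.y)
    (h4 : U.z = V.z) (h5 : U.η = V.η) : U = V :=
  Prod.ext h1 (Prod.ext h2 (Prod.ext h3 (Prod.ext h4 h5)))

theorem inner_self_coe {E : Type} [NormedAddCommGroup E] [InnerProductSpace ℂ E] (x : E) :
    inner ℂ x x = ((‖x‖ ^ 2 : ℝ) : ℂ) := by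
  rw [inner_self_eq_norm_sq_to_K]
  simp

/-- The inner product of the energy space (conjugate-linear in the first slot in Lean):
`∫₀ᴸ (a u_x \overline{u¹_x} + v \overline{v¹} + y_x \overline{y¹_x} + z \overline{z¹}) dx
  + τ |κ₂| ∫₀^β ∫₀¹ η_x \overline{η¹_x} dρ dx`. -/
@[reducible] def energyCore (P : Params) : InnerProductSpace.Core ℂ (State P) where
  inner U V := (P.a : ℂ) * inner ℂ U.u V.u + inner ℂ U.v V.v + inner ℂ U.y V.y
    + inner ℂ U.z V.z + ((P.τ * |P.κ₂| : ℝ) : ℂ) * inner ℂ U.η V.η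
  conj_inner_symm U V := by
    simp only [map_add, map_mul, Complex.conj_ofReal, inner_conj_symm]
  re_inner_nonneg U := by
    simp only [inner_self_coe]
    have h1 := P.ha
    have h2 := P.hτ
    rw [← Complex.ofReal_mul, ← Complex.ofReal_mul, ← Complex.ofReal_add, ← Complex.ofReal_add,
      ← Complex.ofReal_add, ← Complex.ofReal_add]
    rw [RCLike.re_eq_complex_re, Complex.ofReal_re]
    positivity
  add_left U V X := by
    change (P.a : ℂ) * inner ℂ (U.u + V.u) X.u + inner ℂ (U.v + V.v) X.v
      + inner ℂ (U.y + V.y) X.y + inner ℂ (U.z + V.z) X.z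
      + ((P.τ * |P.κ₂| : ℝ) : ℂ) * inner ℂ (U.η + V.η) X.η = _
    simp only [inner_add_left]
    ring
  smul_left U V r := by
    change (P.a : ℂ) * inner ℂ (r • U.u) V.u + inner ℂ (r • U.v) V.v
      + inner ℂ (r • U.y) V.y + inner ℂ (r • U.z) V.z
      + ((P.τ * |P.κ₂| : ℝ) : ℂ) * inner ℂ (r • U.η) V.η = _
    simp only [inner_smul_left]
    ring
  definite U h := by
    have h1 := P.ha
    have h2 : 0 < P.τ * |P.κ₂| := mul_pos P.hτ (abs_pos.2 P.hκ₂)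
    simp only [inner_self_coe] at h
    rw [← Complex.ofReal_mul, ← Complex.ofReal_mul, ← Complex.ofReal_add, ← Complex.ofReal_add,
      ← Complex.ofReal_add, ← Complex.ofReal_add, Complex.ofReal_eq_zero] at h
    have e1 : 0 ≤ P.a * ‖U.u‖ ^ 2 := by positivity
    have e2 : 0 ≤ ‖U.v‖ ^ 2 := by positivity
    have e3 : 0 ≤ ‖U.y‖ ^ 2 := by positivity
    have e4 : 0 ≤ ‖U.z‖ ^ 2 := by positivity
    have e5 : 0 ≤ P.τ * |P.κ₂| * ‖U.η‖ ^ 2 := by positivity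
    have f1 : P.a * ‖U.u‖ ^ 2 = 0 := by linarith
    have f2 : ‖U.v‖ ^ 2 = 0 := by linarith
    have f3 : ‖U.y‖ ^ 2 = 0 := by linarith
    have f4 : ‖U.z‖ ^ 2 = 0 := by linarith
    have f5 : P.τ * |P.κ₂| * ‖U.η‖ ^ 2 = 0 := by linarith
    refine State.ext ?_ ?_ ?_ ?_ ?_
    · exact norm_eq_zero.1 (pow_eq_zero_iff two_ne_zero |>.1
        ((mul_eq_zero.1 f1).resolve_left h1.ne'))
    · exact norm_eq_zero.1 (pow_eq_zero_iff two_ne_zero |>.1 f2)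
    · exact norm_eq_zero.1 (pow_eq_zero_iff two_ne_zero |>.1 f3)
    · exact norm_eq_zero.1 (pow_eq_zero_iff two_ne_zero |>.1 f4)
    · exact norm_eq_zero.1 (pow_eq_zero_iff two_ne_zero |>.1
        ((mul_eq_zero.1 f5).resolve_left h2.ne'))

instance : NormedAddCommGroup (State P) := (energyCore P).toNormedAddCommGroup
instance : InnerProductSpace ℂ (State P) := InnerProductSpace.ofCore (energyCore P).toCore

theorem inner_def (U V : State P) : inner ℂ U V =
    (P.a : ℂ) * inner ℂ U.u V.u + inner ℂ U.v V.v + inner ℂ U.y V.y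
    + inner ℂ U.z V.z + ((P.τ * |P.κ₂| : ℝ) : ℂ) * inner ℂ U.η V.η := rfl

end State

/-! ### The operator `𝒜` -/

/-- The stress `S_b(u, v, η) = a u_x + b (κ₁ v_x + κ₂ η_x(·, 1))`; the argument `e` is
`η(·, 1)`. -/
def stress (P : Params) (u v : H1Zero 0 P.L) (e : H1Left 0 P.β) (x : ℝ) : ℂ :=
  P.a * u.dx x + P.b x * (P.κ₁ * v.dx x + P.κ₂ * e.dx x)

/-- `(U, F)` belongs to the graph of `𝒜`, witnessed by `v, z ∈ H¹₀(0, L)`, the weak derivatives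
`Sx = (S_b(u, v, η))_x` and `yxx = y_xx` in `L²(0, L)`, the weak derivative `ηρ = η_ρ` in `𝒲`, and
the continuous representative `w : [0, 1] → H¹_L(0, β)` of `η`, which gives meaning to `η(·, 0)` and
`η(·, 1)`. The first seven fields say that `U ∈ D(𝒜)`, the last five that `𝒜 U = F`. -/
structure GraphWitness (P : Params) (U F : State P) (v z : H1Zero 0 P.L)
    (Sx yxx : L2 0 P.L ℂ) (ηρ : P.W) (w : ℝ → H1Left 0 P.β) : Prop where
  v_mem : v.fn = U.v
  z_mem : z.fn = U.z
  y_deriv : IsWeakDeriv 0 P.L U.y.dx yxx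
  η_deriv : IsWeakDeriv 0 1 U.η ηρ
  η_rep : IsContRep 0 1 U.η w
  η_zero : (w 0).fn =ᵐ[leb 0 P.β] U.v
  stress_deriv : IsWeakDeriv 0 P.L (stress P U.u v (w 1)) Sx
  u_eq : F.u = v
  v_eq : F.v =ᵐ[leb 0 P.L] fun x => Sx x - P.c x * U.z x
  y_eq : F.y = z
  z_eq : F.z =ᵐ[leb 0 P.L] fun x => yxx x + P.c x * U.v x
  η_eq : F.η = (-(P.τ : ℂ)⁻¹) • ηρ

section Stress

variable {P : Params}

theorem ae_b {p : ℝ → Prop} (h : ∀ᵐ x ∂leb 0 P.β, p x) :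
    ∀ᵐ x ∂leb 0 P.L, P.b x = 0 ∨ p x := by
  refine ae_restrict_of_ae ?_
  filter_upwards [(ae_restrict_iff' measurableSet_Ioo).1 h] with x hx
  by_cases hxm : x ∈ Ioo 0 P.β
  · exact Or.inr (hx hxm)
  · exact Or.inl (indicator_of_notMem hxm _)

theorem leb_mono : leb 0 P.β ≤ leb 0 P.L :=
  Measure.restrict_mono (Ioo_subset_Ioo_right (P.hβγ.trans P.hγL).le) le_rfl

theorem stress_add (u v u' v' : H1Zero 0 P.L) (e e' : H1Left 0 P.β) :
    stress P (u + u') (v + v') (e + e') =ᵐ[leb 0 P.L]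
      fun x => stress P u v e x + stress P u' v' e' x := by
  filter_upwards [Lp.coeFn_add u.dx u'.dx, Lp.coeFn_add v.dx v'.dx,
    ae_b (Lp.coeFn_add e.dx e'.dx)] with x h1 h2 h3
  simp only [stress, map_add, h1, h2, Pi.add_apply]
  rcases h3 with h3 | h3
  · rw [h3]; ring
  · rw [h3, Pi.add_apply]; ring

theorem stress_smul (r : ℂ) (u v : H1Zero 0 P.L) (e : H1Left 0 P.β) :
    stress P (r • u) (r • v) (r • e) =ᵐ[leb 0 P.L] fun x => r • stress P u v e x := by
  filter_upwards [Lp.coeFn_smul r u.dx, Lp.coeFn_smul r v.dx,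
    ae_b (Lp.coeFn_smul r e.dx)] with x h1 h2 h3
  simp only [stress, map_smul, h1, h2, Pi.smul_apply, smul_eq_mul]
  rcases h3 with h3 | h3
  · rw [h3]; ring
  · rw [h3, Pi.smul_apply, smul_eq_mul]; ring

theorem stress_zero : stress P 0 0 0 =ᵐ[leb 0 P.L] fun _ => 0 := by
  have h := stress_smul (P := P) 0 0 0 0
  simpa using h

theorem stress_integrable (u v : H1Zero 0 P.L) (e : H1Left 0 P.β) :
    Integrable (stress P u v e) (leb 0 P.L) := by
  have hβ : Ioo 0 P.β ⊆ Ioo 0 P.L := Ioo_subset_Ioo_right (P.hβγ.trans P.hγL).le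
  have h : Integrable ((Ioo 0 P.β).indicator fun x => P.κ₁ * v.dx x + P.κ₂ * e.dx x)
      (leb 0 P.L) := by
    rw [integrable_indicator_iff measurableSet_Ioo, IntegrableOn,
      Measure.restrict_restrict_of_subset hβ]
    exact ((v.dx.integrable.mono_measure leb_mono).const_mul _).add (e.dx.integrable.const_mul _)
  refine ((u.dx.integrable.const_mul (P.a : ℂ)).add h).congr
    (Filter.Eventually.of_forall fun x => ?_)
  by_cases hx : x ∈ Ioo 0 P.β
  · simp [stress, Params.b, hx]
  · simp [stress, Params.b, hx]

end Stress

/-- The graph of `𝒜`. -/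
def graphA (P : Params) : Submodule ℂ (State P × State P) where
  carrier := {X | ∃ v z Sx yxx ηρ w, GraphWitness P X.1 X.2 v z Sx yxx ηρ w}
  zero_mem' := by
    refine ⟨0, 0, 0, 0, 0, fun _ => 0, map_zero _, map_zero _, ?_, ?_, ?_, ?_, ?_, rfl, ?_, rfl,
      ?_, (smul_zero _).symm⟩
    · exact IsWeakDeriv.zero.congr (by
        change ⇑(H1Van.dx (0 : H1Zero 0 P.L)) =ᵐ[_] _
        rw [map_zero]; exact Lp.coeFn_zero _ _ _) (Lp.coeFn_zero _ _ _)
    · exact IsWeakDeriv.zero.congr (Lp.coeFn_zero _ _ _) (Lp.coeFn_zero _ _ _)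
    · exact ⟨continuousOn_const, Lp.coeFn_zero _ _ _⟩
    · rw [map_zero]
      exact (Lp.coeFn_zero _ _ _).trans (ae_mono leb_mono (Lp.coeFn_zero ℂ 2 (leb 0 P.L)).symm)
    · exact IsWeakDeriv.zero.congr stress_zero (Lp.coeFn_zero _ _ _)
    · change ⇑(0 : L2 0 P.L ℂ) =ᵐ[_] fun x => (0 : L2 0 P.L ℂ) x - P.c x * (0 : L2 0 P.L ℂ) x
      filter_upwards [Lp.coeFn_zero ℂ 2 (leb 0 P.L)] with x hx
      rw [hx, Pi.zero_apply, mul_zero, sub_zero]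
    · change ⇑(0 : L2 0 P.L ℂ) =ᵐ[_] fun x => (0 : L2 0 P.L ℂ) x + P.c x * (0 : L2 0 P.L ℂ) x
      filter_upwards [Lp.coeFn_zero ℂ 2 (leb 0 P.L)] with x hx
      rw [hx, Pi.zero_apply, mul_zero, add_zero]
  add_mem' := by
    rintro ⟨U, F⟩ ⟨U', F'⟩ ⟨v, z, Sx, yxx, ηρ, w, h⟩ ⟨v', z', Sx', yxx', ηρ', w', h'⟩
    refine ⟨v + v', z + z', Sx + Sx', yxx + yxx', ηρ + ηρ', fun ρ => w ρ + w' ρ, ?_, ?_, ?_, ?_,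
      ?_, ?_, ?_, ?_, ?_, ?_, ?_, ?_⟩
    · rw [map_add, h.v_mem, h'.v_mem]; rfl
    · rw [map_add, h.z_mem, h'.z_mem]; rfl
    · refine (h.y_deriv.add h'.y_deriv U.y.dx.integrable yxx.integrable U'.y.dx.integrable
        yxx'.integrable).congr ?_ (Lp.coeFn_add _ _)
      change ⇑(H1Van.dx (U.y + U'.y)) =ᵐ[_] _
      rw [map_add]; exact Lp.coeFn_add _ _
    · exact (h.η_deriv.add h'.η_deriv U.η.integrable ηρ.integrable U'.η.integrable
        ηρ'.integrable).congr (Lp.coeFn_add _ _) (Lp.coeFn_add _ _)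
    · exact ⟨h.η_rep.cont.add h'.η_rep.cont,
        (Lp.coeFn_add _ _).trans (h.η_rep.ae_eq.add h'.η_rep.ae_eq)⟩
    · rw [map_add]
      exact (Lp.coeFn_add _ _).trans ((h.η_zero.add h'.η_zero).trans
        (ae_mono leb_mono (Lp.coeFn_add U.v U'.v).symm))
    · exact (h.stress_deriv.add h'.stress_deriv (stress_integrable _ _ _) Sx.integrable
        (stress_integrable _ _ _) Sx'.integrable).congr (stress_add _ _ _ _ _ _)
        (Lp.coeFn_add _ _)
    · change F.u + F'.u = _
      rw [h.u_eq, h'.u_eq]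
    · change ⇑(F.v + F'.v) =ᵐ[_] fun x => (Sx + Sx') x - P.c x * (U.z + U'.z) x
      filter_upwards [Lp.coeFn_add F.v F'.v, Lp.coeFn_add Sx Sx', Lp.coeFn_add U.z U'.z, h.v_eq,
        h'.v_eq] with x h1 h2 h3 h4 h5
      simp only [h1, h2, h3, Pi.add_apply, h4, h5]
      ring
    · change F.y + F'.y = _
      rw [h.y_eq, h'.y_eq]
    · change ⇑(F.z + F'.z) =ᵐ[_] fun x => (yxx + yxx') x + P.c x * (U.v + U'.v) x
      filter_upwards [Lp.coeFn_add F.z F'.z, Lp.coeFn_add yxx yxx', Lp.coeFn_add U.v U'.v, h.z_eq,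
        h'.z_eq] with x h1 h2 h3 h4 h5
      simp only [h1, h2, h3, Pi.add_apply, h4, h5]
      ring
    · change F.η + F'.η = _
      rw [h.η_eq, h'.η_eq, smul_add]
  smul_mem' := by
    rintro r ⟨U, F⟩ ⟨v, z, Sx, yxx, ηρ, w, h⟩
    refine ⟨r • v, r • z, r • Sx, r • yxx, r • ηρ, fun ρ => r • w ρ, ?_, ?_, ?_, ?_,
      ?_, ?_, ?_, ?_, ?_, ?_, ?_, ?_⟩
    · rw [map_smul, h.v_mem]; rfl
    · rw [map_smul, h.z_mem]; rfl
    · refine (h.y_deriv.const_smul r).congr ?_ (Lp.coeFn_smul _ _)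
      change ⇑(H1Van.dx (r • U.y)) =ᵐ[_] _
      rw [map_smul]; exact Lp.coeFn_smul _ _
    · exact (h.η_deriv.const_smul r).congr (Lp.coeFn_smul _ _) (Lp.coeFn_smul _ _)
    · exact ⟨h.η_rep.cont.const_smul r, (Lp.coeFn_smul _ _).trans (h.η_rep.ae_eq.const_smul r)⟩
    · rw [map_smul]
      exact (Lp.coeFn_smul _ _).trans ((h.η_zero.const_smul r).trans
        (ae_mono leb_mono (Lp.coeFn_smul r U.v).symm))
    · exact (h.stress_deriv.const_smul r).congr (stress_smul _ _ _ _) (Lp.coeFn_smul _ _)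
    · change r • F.u = _
      rw [h.u_eq]
    · change ⇑(r • F.v) =ᵐ[_] fun x => (r • Sx) x - P.c x * (r • U.z) x
      filter_upwards [Lp.coeFn_smul r F.v, Lp.coeFn_smul r Sx, Lp.coeFn_smul r U.z, h.v_eq]
        with x h1 h2 h3 h4
      simp only [h1, h2, h3, Pi.smul_apply, h4, smul_eq_mul]
      ring
    · change r • F.y = _
      rw [h.y_eq]
    · change ⇑(r • F.z) =ᵐ[_] fun x => (r • yxx) x + P.c x * (r • U.v) x
      filter_upwards [Lp.coeFn_smul r F.z, Lp.coeFn_smul r yxx, Lp.coeFn_smul r U.v, h.z_eq]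
        with x h1 h2 h3 h4
      simp only [h1, h2, h3, Pi.smul_apply, h4, smul_eq_mul]
      ring
    · change r • F.η = _
      rw [h.η_eq, smul_comm]

/-- The graph of `𝒜` is the graph of a single-valued operator. -/
theorem graphA_single (P : Params) (X : State P × State P) (hX : X ∈ graphA P) (h0 : X.1 = 0) :
    X.2 = 0 := by
  obtain ⟨U, F⟩ := X
  obtain ⟨v, z, Sx, yxx, ηρ, w, h⟩ := hX
  change U = 0 at h0
  subst h0
  have hv : v = 0 := H1Van.fn_eq_zero h.v_mem
  have hz : z = 0 := H1Van.fn_eq_zero h.z_mem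
  have hw1 : w 1 = 0 := h.η_rep.eqOn_zero one_pos (Lp.coeFn_zero _ _ _) (right_mem_Icc.2 zero_le_one)
  have hSx : Sx =ᵐ[leb 0 P.L] 0 := by
    refine IsWeakDeriv.unique_zero Sx.integrable
      (h.stress_deriv.congr ?_ Filter.EventuallyEq.rfl)
    rw [hv, hw1]
    exact stress_zero.symm
  have hy : yxx =ᵐ[leb 0 P.L] 0 := by
    refine IsWeakDeriv.unique_zero yxx.integrable (h.y_deriv.congr ?_ Filter.EventuallyEq.rfl)
    change _ =ᵐ[_] ⇑(H1Van.dx (0 : H1Zero 0 P.L))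
    rw [map_zero]; exact (Lp.coeFn_zero _ _ _).symm
  have hη : ηρ =ᵐ[leb 0 1] 0 :=
    IsWeakDeriv.unique_zero ηρ.integrable
      (h.η_deriv.congr (Lp.coeFn_zero _ _ _).symm Filter.EventuallyEq.rfl)
  have h00 : ⇑(0 : L2 0 P.L ℂ) =ᵐ[leb 0 P.L] 0 := Lp.coeFn_zero _ _ _
  refine State.ext (h.u_eq.trans hv) ?_ (h.y_eq.trans hz) ?_ ?_
  · refine (Lp.eq_zero_iff_ae_eq_zero).2 ?_
    filter_upwards [h.v_eq, hSx, h00] with x h1 h2 h3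
    rw [h1, h2]
    change (0 : ℂ) - P.c x * (0 : L2 0 P.L ℂ) x = 0
    rw [h3]; simp
  · refine (Lp.eq_zero_iff_ae_eq_zero).2 ?_
    filter_upwards [h.z_eq, hy, h00] with x h1 h2 h3
    rw [h1, h2]
    change (0 : ℂ) + P.c x * (0 : L2 0 P.L ℂ) x = 0
    rw [h3]; simp
  · have : ηρ = 0 := (Lp.eq_zero_iff_ae_eq_zero).2 hη
    rw [h.η_eq, this, smul_zero]; rfl

/-- The unbounded operator `𝒜 : D(𝒜) ⊂ ℋ → ℋ`,
`𝒜 (u, v, y, z, η) = (v, (S_b(u, v, η))_x - c z, z, y_xx + c v, -τ⁻¹ η_ρ)`. -/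
def opA (P : Params) : State P →ₗ.[ℂ] State P := (graphA P).toLinearPMap

/-- `𝒜` is the operator whose graph is described by `GraphWitness`. -/
theorem mem_graph_opA (P : Params) (U F : State P) : (U, F) ∈ (opA P).graph ↔
    ∃ v z Sx yxx ηρ w, GraphWitness P U F v z Sx yxx ηρ w := by
  rw [opA, Submodule.toLinearPMap_graph_eq _ (graphA_single P)]
  rfl

/-- The resolvent set of an unbounded operator `T`: the `μ ∈ ℂ` for which `μ - T` is a bijection
from `D(T)` onto the whole space with bounded inverse `R`. -/
def resolventSet {X : Type} [NormedAddCommGroup X] [NormedSpace ℂ X] (T : X →ₗ.[ℂ] X) : Set ℂ :=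
  {μ | ∃ R : X →L[ℂ] X,
    (∀ F : X, ∃ U : T.domain, (U : X) = R F ∧ μ • (U : X) - T U = F) ∧
    ∀ U : T.domain, R (μ • (U : X) - T U) = U}

end

end KelvinVoigt

/-!
The resolvent equation `(ir - 𝒜) U = F` on the imaginary axis is reduced to a boundary value
problem for a linear system of ordinary differential equations, which is solved by shooting.

Since `v = ir u - f₁`, `z = ir y - f₃` and the transport equation for the delay gives
`η(·, 1) = e^{-irτ} v + G` with `G` depending only on the data (`delayRep`, `delayEnd`), the
stress is `S = m u_x + data`, where `m = a + ir b k` and `k = κ₁ + κ₂ e^{-irτ}`. The vector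
`X = (u, S, y, y_x)` then satisfies a first-order system `X' = A(x) X + f` with bounded, piecewise
constant `A`, with `u` and `y` vanishing at `0` and `L`. Under (H) the real part of `k` is
positive, so `m ≠ 0`.

In integral form the initial value problem is a Volterra equation; its operator `K` has a power of
norm less than one, so `1 - K` is invertible (`isUnit_one_sub_volterra`). Everything is set up
with bounded operators between `L²` and the bounded continuous functions on the line, so that the
resolvent comes out bounded without any further estimate.

The boundary value problem has at most one solution (`solution_eq_zero`). For `r ≠ 0` the
imaginary part of the derivative of `S ū + y_x ȳ` is `r Re k |S|² / |m|²` on `(0, β)` and zero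
elsewhere, because the coupling contributes a real term. Integrating over `(0, L)` shows that
`S = 0` on `(0, β)`. Then `u_x = 0` and `u = 0` there, the equation for `S` forces `y = 0` on the
coupling region `(α, β)`, and the conservation of `|y_x|² + r² |y|²` on `(0, β)` gives `X(0) = 0`.
For `r = 0` both equations are `f'' = 0`. By uniqueness the linear map from `(S, y_x)(0)` to
`(u, y)(L)` on `ℂ²` is injective, hence invertible, and the initial values can be adjusted to the
boundary conditions (`exists_solution_operator`).

The solution of the system yields a bounded right inverse of `ir - 𝒜` (`exists_resolvent`), and an
element of the kernel of `ir - 𝒜` yields a homogeneous solution of the system, so the kernel is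
trivial (`eq_zero_of_mem_graphA`).
-/

namespace KelvinVoigt

open MeasureTheory Set
open scoped ContDiff BoundedContinuousFunction ENNReal

noncomputable section

/-! ### Primitives of `L²` functions -/

section Primitive

variable {E F : Type} [NormedAddCommGroup E] [NormedAddCommGroup F] {p q : ℝ}

/-- On a bounded interval the `L¹` norm is controlled by the `L²` norm. -/
theorem integral_norm_le_norm (f : L2 p q E) :
    ∫ x, ‖f x‖ ∂leb p q ≤ ((leb p q univ) ^ ((1 : ℝ) / 2)).toReal * ‖f‖ := by
  have hf := Lp.memLp f
  have h1 := eLpNorm_le_eLpNorm_mul_rpow_measure_univ (μ := leb p q) (p := 1) (q := 2)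
    (by norm_num) hf.1
  have h2 : ∫ x, ‖f x‖ ∂leb p q = (eLpNorm f 1 (leb p q)).toReal := by
    rw [eLpNorm_one_eq_lintegral_enorm, integral_norm_eq_lintegral_enorm hf.1]
  have h3 : (leb p q univ) ^ ((1 : ℝ) / 2) ≠ ⊤ :=
    ENNReal.rpow_ne_top_of_nonneg (by norm_num) (measure_ne_top _ _)
  have h4 : ((1 : ℝ) / ENNReal.toReal 1 - 1 / ENNReal.toReal 2) = 1 / 2 := by norm_num
  rw [h4] at h1
  rw [h2, Lp.norm_def, mul_comm, ← ENNReal.toReal_mul]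
  exact ENNReal.toReal_mono (ENNReal.mul_ne_top hf.2.ne h3) h1

theorem integrable_bcf (X : ℝ →ᵇ E) : Integrable X (leb p q) :=
  Integrable.of_bound X.continuous.aestronglyMeasurable ‖X‖
    (Filter.Eventually.of_forall X.norm_coe_le_norm)

/-- Continuous functions that agree almost everywhere on `(p, q)` agree on `[p, q]`. -/
theorem eqOn_Icc_of_ae_eq (hpq : p < q) {f g : ℝ → E} (hf : ContinuousOn f (Icc p q))
    (hg : ContinuousOn g (Icc p q)) (h : f =ᵐ[leb p q] g) : EqOn f g (Icc p q) := by
  have hEq : EqOn f g (Ioo p q) :=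
    Measure.eqOn_open_of_ae_eq h isOpen_Ioo (hf.mono Ioo_subset_Icc_self)
      (hg.mono Ioo_subset_Icc_self)
  refine hEq.of_subset_closure hf hg Ioo_subset_Icc_self ?_
  rw [closure_Ioo hpq.ne]

variable [NormedSpace ℂ E] [NormedSpace ℂ F]

theorem norm_intervalIntegral_leb_le (f : L2 p q E) (x : ℝ) :
    ‖∫ t in p..x, f t ∂leb p q‖ ≤ ∫ t, ‖f t‖ ∂leb p q := by
  refine (intervalIntegral.norm_integral_le_integral_norm_uIoc).trans ?_
  exact setIntegral_le_integral f.integrable.norm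
    (Filter.Eventually.of_forall fun _ => norm_nonneg _)

/-- The primitive `x ↦ ∫ₚˣ f` of `f ∈ L²(p, q)`, extended by constants outside `[p, q]`, as an
operator into the bounded continuous functions on the line. -/
def prim (p q : ℝ) : L2 p q E →L[ℂ] (ℝ →ᵇ E) :=
  LinearMap.mkContinuous
    { toFun := fun f => BoundedContinuousFunction.ofNormedAddCommGroup
        (fun x => ∫ t in p..x, f t ∂leb p q) (f.integrable.continuous_primitive p)
        (∫ t, ‖f t‖ ∂leb p q) (norm_intervalIntegral_leb_le f)
      map_add' := fun f g => by
        ext x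
        change ∫ t in p..x, (f + g) t ∂leb p q =
          (∫ t in p..x, f t ∂leb p q) + ∫ t in p..x, g t ∂leb p q
        rw [← intervalIntegral.integral_add f.integrable.intervalIntegrable
          g.integrable.intervalIntegrable]
        refine intervalIntegral.integral_congr_ae ?_
        filter_upwards [Lp.coeFn_add f g] with t ht _
        exact ht
      map_smul' := fun c f => by
        ext x
        change ∫ t in p..x, (c • f) t ∂leb p q = c • ∫ t in p..x, f t ∂leb p q
        rw [← intervalIntegral.integral_smul]
        refine intervalIntegral.integral_congr_ae ?_
        filter_upwards [Lp.coeFn_smul c f] with t ht _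
        exact ht }
    ((leb p q univ) ^ ((1 : ℝ) / 2)).toReal
    (fun f => BoundedContinuousFunction.norm_ofNormedAddCommGroup_le _
      (by positivity) fun x => (norm_intervalIntegral_leb_le f x).trans (integral_norm_le_norm f))

theorem prim_apply (f : L2 p q E) (x : ℝ) : prim p q f x = ∫ t in p..x, f t ∂leb p q := rfl

@[simp] theorem prim_left (f : L2 p q E) : prim p q f p = 0 := by
  rw [prim_apply, intervalIntegral.integral_same]

theorem intervalIntegral_leb {G : Type} [NormedAddCommGroup G] [NormedSpace ℝ G] (f : ℝ → G)
    {x : ℝ} (hx : x ∈ Icc p q) :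
    ∫ t in p..x, f t ∂leb p q = ∫ t in p..x, f t := by
  rw [intervalIntegral.integral_of_le hx.1, intervalIntegral.integral_of_le hx.1,
    Measure.restrict_restrict measurableSet_Ioc, integral_Ioc_eq_integral_Ioo]
  refine setIntegral_congr_set ?_
  have h : (Ioo p q : Set ℝ) =ᵐ[volume] Ioc p q := Ioo_ae_eq_Ioc
  have h2 : (Ioc p x : Set ℝ) =ᵐ[volume] Ioo p x := Ioo_ae_eq_Ioc.symm
  have h3 : (Ioc p x ∩ Ioo p q : Set ℝ) =ᵐ[volume] (Ioc p x ∩ Ioc p q : Set ℝ) :=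
    (Filter.EventuallyEq.refl _ _).inter h
  rw [inter_eq_left.2 (Ioc_subset_Ioc_right hx.2)] at h3
  exact h3.trans h2

theorem prim_eq (f : L2 p q E) {x : ℝ} (hx : x ∈ Icc p q) :
    prim p q f x = ∫ t in p..x, f t := by
  rw [prim_apply, intervalIntegral_leb _ hx]

theorem prim_of_le (f : L2 p q E) {x : ℝ} (hx : x ≤ p) : prim p q f x = 0 := by
  rw [prim_apply, intervalIntegral.integral_of_ge hx,
    Measure.restrict_restrict measurableSet_Ioc]
  have : Ioc x p ∩ Ioo p q = ∅ := by
    ext t; simp only [mem_inter_iff, mem_Ioc, mem_Ioo, mem_empty_iff_false, iff_false]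
    rintro ⟨⟨_, h1⟩, h2, _⟩; linarith
  simp [this]

theorem prim_of_ge (f : L2 p q E) (hpq : p ≤ q) {x : ℝ} (hx : q ≤ x) :
    prim p q f x = prim p q f q := by
  rw [prim_apply, prim_apply, intervalIntegral.integral_of_le (hpq.trans hx),
    intervalIntegral.integral_of_le hpq, Measure.restrict_restrict measurableSet_Ioc,
    Measure.restrict_restrict measurableSet_Ioc]
  congr 2
  ext t
  simp only [mem_inter_iff, mem_Ioc, mem_Ioo]
  constructor
  · rintro ⟨⟨h1, h2⟩, h3, h4⟩; exact ⟨⟨h1, h4.le⟩, h3, h4⟩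
  · rintro ⟨⟨h1, h2⟩, h3, h4⟩; exact ⟨⟨h1, h2.trans hx⟩, h3, h4⟩

theorem map_prim [CompleteSpace E] [CompleteSpace F] (T : E →L[ℂ] F) (f : L2 p q E) (x : ℝ) :
    T (prim p q f x) = prim p q (T.compLpL 2 (leb p q) f) x := by
  rw [prim_apply, prim_apply, ← T.intervalIntegral_comp_comm f.integrable.intervalIntegrable]
  refine intervalIntegral.integral_congr_ae ?_
  filter_upwards [T.coeFn_compLpL f] with t ht _
  exact ht.symm

/-- The primitive of `f ∈ L²` has weak derivative `f`; the Banach-valued case follows from the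
scalar one by testing with the dual. -/
theorem isWeakDeriv_prim [CompleteSpace E] (hpq : p < q) (f : L2 p q E) :
    IsWeakDeriv p q (prim p q f) f := by
  intro φ hφ
  have hi : Integrable (prim p q f) (leb p q) :=
    integrable_bcf _
  have i1 := hφ.integrable_deriv_smul hi
  have i2 := hφ.integrable_smul f.integrable
  refine (SeparatingDual.eq_iff_forall_dual_eq (R := ℂ)).2 fun ℓ => ?_
  have := isWeakDeriv_primitive hpq (ℓ.integrable_comp f.integrable) φ hφ
  rw [map_neg, ← ℓ.integral_comp_comm i1, ← ℓ.integral_comp_comm i2]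
  simp only [ℓ.map_smul_of_tower]
  refine Eq.trans ?_ this
  refine setIntegral_congr_fun measurableSet_Ioo fun x hx => ?_
  have hsub : IntervalIntegrable f volume p x := by
    rw [intervalIntegrable_iff_integrableOn_Ioo_of_le hx.1.le]
    exact IntegrableOn.mono_set f.integrable (Ioo_subset_Ioo_right hx.2.le)
  change _ = deriv φ x • ∫ t in p..x, ℓ (f t)
  rw [ℓ.intervalIntegral_comp_comm hsub, prim_eq f (Ioo_subset_Icc_self hx)]

theorem isWeakDeriv_const [CompleteSpace E] (c : E) :
    IsWeakDeriv p q (fun _ => c) (fun _ => 0) := by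
  intro φ hφ
  rcases le_or_gt q p with hqp | hpq
  · simp [Ioo_eq_empty (not_lt.2 hqp)]
  have hi : Integrable (deriv φ) (leb p q) :=
    (hφ.deriv_cont.integrable_of_hasCompactSupport hφ.compact.deriv).restrict
  have hpφ : φ p = 0 := image_eq_zero_of_notMem_tsupport fun h => (lt_irrefl p (hφ.supp h).1)
  have hqφ : φ q = 0 := image_eq_zero_of_notMem_tsupport fun h => (lt_irrefl q (hφ.supp h).2)
  have h : ∫ x in Ioo p q, deriv φ x = 0 := by
    rw [← integral_Ioc_eq_integral_Ioo, ← intervalIntegral.integral_of_le hpq.le,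
      intervalIntegral.integral_deriv_eq_sub' φ rfl
        (fun x _ => (hφ.smooth.differentiable (by simp)) x) hφ.deriv_cont.continuousOn,
      hpφ, hqφ, sub_zero]
  have h' : ∫ x in Ioo p q, deriv φ x • c = (∫ x in Ioo p q, deriv φ x) • c :=
    integral_smul_const (deriv φ) c
  rw [h', h]
  simp

/-- A function with weak derivative in `L²` agrees almost everywhere with a constant plus the
primitive of its derivative. -/
theorem IsWeakDeriv.exists_ae_eq_prim [CompleteSpace E] (hpq : p < q) {f : ℝ → E}
    (hf : Integrable f (leb p q)) {g : L2 p q E} (h : IsWeakDeriv p q f g) :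
    ∃ c : E, f =ᵐ[leb p q] fun x => c + prim p q g x := by
  have hi : Integrable (prim p q g) (leb p q) := integrable_bcf _
  have h' := (isWeakDeriv_prim hpq g).const_smul (-1)
  have hsum := h.add h' hf g.integrable (hi.smul (-1 : ℂ)) (g.integrable.smul (-1 : ℂ))
  have h0 : IsWeakDeriv p q (fun x => f x + (-1 : ℂ) • prim p q g x) (fun _ => 0) :=
    hsum.congr Filter.EventuallyEq.rfl (Filter.Eventually.of_forall fun x => by simp)
  obtain ⟨c, hc⟩ := h0.ae_const (hf.add (hi.smul (-1 : ℂ)))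
  refine ⟨c, ?_⟩
  filter_upwards [hc] with x hx
  rw [← hx]; simp

theorem isWeakDeriv_const_add_prim [CompleteSpace E] (hpq : p < q) (c : E) (f : L2 p q E) :
    IsWeakDeriv p q (fun x => c + prim p q f x) f :=
  ((isWeakDeriv_const c).add (isWeakDeriv_prim hpq f) (integrable_const c) (integrable_const 0)
    (integrable_bcf _) f.integrable).congr Filter.EventuallyEq.rfl
    (Filter.Eventually.of_forall fun _ => (zero_add _).symm)

end Primitive

/-! ### Exponential factors -/

section Exponential

variable {E : Type} [NormedAddCommGroup E] [NormedSpace ℂ E] {p q : ℝ}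

/-- The product rule for a smooth real factor. -/
theorem IsWeakDeriv.smul_smooth {f g : ℝ → E} (h : IsWeakDeriv p q f g)
    (hf : Integrable f (leb p q)) (hg : Integrable g (leb p q)) {ψ : ℝ → ℝ}
    (hψ : ContDiff ℝ ∞ ψ) :
    IsWeakDeriv p q (fun x => ψ x • f x) (fun x => deriv ψ x • f x + ψ x • g x) := by
  intro φ hφ
  have hφψ : IsTest p q (fun x => φ x * ψ x) :=
    ⟨hφ.smooth.mul hψ, hφ.compact.mul_right, tsupport_mul_subset_left.trans hφ.supp⟩
  have hφψ' : IsTest p q (fun x => φ x * deriv ψ x) :=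
    ⟨hφ.smooth.mul (contDiff_infty_iff_deriv.1 hψ).2, hφ.compact.mul_right,
      tsupport_mul_subset_left.trans hφ.supp⟩
  have hd : ∀ x, deriv (fun x => φ x * ψ x) x = deriv φ x * ψ x + φ x * deriv ψ x := fun x =>
    deriv_fun_mul (hφ.smooth.differentiable (by simp) x) (hψ.differentiable (by simp) x)
  have key := h _ hφψ
  have i1 := hφψ.integrable_deriv_smul hf
  have i2 := hφψ'.integrable_smul hf
  have i3 := hφψ.integrable_smul hg
  have e1 : ∫ x in Ioo p q, deriv φ x • ψ x • f x =
      (∫ x in Ioo p q, deriv (fun x => φ x * ψ x) x • f x) -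
        ∫ x in Ioo p q, (φ x * deriv ψ x) • f x := by
    rw [← integral_sub i1 i2]
    refine integral_congr_ae (Filter.Eventually.of_forall fun x => ?_)
    simp only [hd, add_smul, mul_smul]
    abel
  have e2 : ∫ x in Ioo p q, φ x • (deriv ψ x • f x + ψ x • g x) =
      (∫ x in Ioo p q, (φ x * deriv ψ x) • f x) + ∫ x in Ioo p q, (φ x * ψ x) • g x := by
    rw [← integral_add i2 i3]
    refine integral_congr_ae (Filter.Eventually.of_forall fun x => ?_)
    simp only [smul_add, mul_smul]
  rw [e1, e2, key]
  abel

/-- The product rule for the factor `e^{iθx}`. -/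
theorem IsWeakDeriv.exp_smul {f g : ℝ → E} (h : IsWeakDeriv p q f g)
    (hf : Integrable f (leb p q)) (hg : Integrable g (leb p q)) (θ : ℝ) :
    IsWeakDeriv p q (fun x => Complex.exp (Complex.I * θ * x) • f x)
      (fun x => Complex.exp (Complex.I * θ * x) • (g x + (Complex.I * θ) • f x)) := by
  have bdd : ∀ {ψ : ℝ → ℝ} {k : ℝ → E}, Continuous ψ → (∃ C, ∀ x, ‖ψ x‖ ≤ C) →
      Integrable k (leb p q) → Integrable (fun x => ψ x • k x) (leb p q) := by
    rintro ψ k hψ ⟨C, hC⟩ hk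
    exact Integrable.bdd_smul (𝕜 := ℝ) hk C hψ.aestronglyMeasurable (Filter.Eventually.of_forall hC)
  have hc : ContDiff ℝ ∞ fun x => Real.cos (θ * x) := by fun_prop
  have hs : ContDiff ℝ ∞ fun x => Real.sin (θ * x) := by fun_prop
  have dc : deriv (fun x => Real.cos (θ * x)) = fun x => -(θ * Real.sin (θ * x)) := by
    funext x
    have := ((hasDerivAt_id x).const_mul θ).cos
    simp only [id, mul_one] at this
    rw [this.deriv]; ring
  have ds : deriv (fun x => Real.sin (θ * x)) = fun x => θ * Real.cos (θ * x) := by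
    funext x
    have := ((hasDerivAt_id x).const_mul θ).sin
    simp only [id, mul_one] at this
    rw [this.deriv]; ring
  have bc : ∃ C, ∀ x, ‖Real.cos (θ * x)‖ ≤ C := ⟨1, fun x => Real.abs_cos_le_one _⟩
  have bs : ∃ C, ∀ x, ‖Real.sin (θ * x)‖ ≤ C := ⟨1, fun x => Real.abs_sin_le_one _⟩
  have bdc : ∃ C, ∀ x, ‖-(θ * Real.sin (θ * x))‖ ≤ C := ⟨|θ|, fun x => by
    rw [norm_neg, norm_mul, Real.norm_eq_abs, Real.norm_eq_abs]
    exact mul_le_of_le_one_right (abs_nonneg _) (Real.abs_sin_le_one _)⟩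
  have bds : ∃ C, ∀ x, ‖θ * Real.cos (θ * x)‖ ≤ C := ⟨|θ|, fun x => by
    rw [norm_mul, Real.norm_eq_abs, Real.norm_eq_abs]
    exact mul_le_of_le_one_right (abs_nonneg _) (Real.abs_cos_le_one _)⟩
  have h1 := h.smul_smooth hf hg hc
  have h2 := (h.smul_smooth hf hg hs).const_smul Complex.I
  rw [dc] at h1
  rw [ds] at h2
  have i1 := bdd hc.continuous bc hf
  have i2 := (bdd (ψ := fun x => -(θ * Real.sin (θ * x))) (by fun_prop) bdc hf).add
    (bdd hc.continuous bc hg)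
  have i3 := (bdd hs.continuous bs hf).smul Complex.I
  have i4 := ((bdd (ψ := fun x => θ * Real.cos (θ * x)) (by fun_prop) bds hf).add
    (bdd hs.continuous bs hg)).smul Complex.I
  have e : ∀ x : ℝ, Complex.exp (Complex.I * θ * x) =
      (Real.cos (θ * x) : ℂ) + Complex.I * (Real.sin (θ * x) : ℂ) := fun x => by
    rw [mul_assoc, mul_comm Complex.I, Complex.exp_mul_I]
    push_cast; ring
  refine (h1.add h2 i1 i2 i3 i4).congr ?_ ?_
  · refine Filter.Eventually.of_forall fun x => ?_
    simp only [e, add_smul, mul_smul, Complex.coe_smul]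
  · refine Filter.Eventually.of_forall fun x => ?_
    simp only [e, ← Complex.coe_smul, smul_add, smul_smul]
    match_scalars
    · ring
    · linear_combination ((θ : ℂ) * Complex.sin (θ * x)) * Complex.I_sq

end Exponential

/-! ### Operators on `L²` and Volterra equations -/

section Operators

variable {E : Type} [NormedAddCommGroup E] {p q : ℝ}

theorem memLp_indicator {q' : ℝ} (h : q' ≤ q) (f : L2 p q' E) :
    MemLp ((Ioo p q').indicator f) 2 (leb p q) := by
  rw [memLp_indicator_iff_restrict measurableSet_Ioo,
    Measure.restrict_restrict_of_subset (Ioo_subset_Ioo_right h)]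
  exact Lp.memLp f

/-- A property that holds almost everywhere on `(p, q')` holds at almost all points of any interval
that lie in `(p, q')`. -/
theorem ae_indicator {q' : ℝ} {P : ℝ → Prop} (h : ∀ᵐ x ∂leb p q', P x) :
    ∀ᵐ x ∂leb p q, x ∈ Ioo p q' → P x :=
  ae_restrict_of_ae ((ae_restrict_iff' measurableSet_Ioo).1 h)

variable [NormedSpace ℂ E]

/-- The restriction of a bounded continuous function to `(p, q)`, as an element of `L²`. -/
abbrev toL2 (p q : ℝ) : (ℝ →ᵇ E) →L[ℂ] L2 p q E :=
  BoundedContinuousFunction.toLp 2 (leb p q) ℂ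

theorem coeFn_toL2 (X : ℝ →ᵇ E) : toL2 p q X =ᵐ[leb p q] X :=
  BoundedContinuousFunction.coeFn_toLp 2 (leb p q) ℂ X

/-- Multiplication by an essentially bounded function, as an operator on `L²`. -/
def mulL {h : ℝ → ℂ} (hh : MemLp h ∞ (leb p q)) : L2 p q E →L[ℂ] L2 p q E :=
  (ContinuousLinearMap.lsmul ℂ ℂ).holderL (leb p q) ∞ 2 2 hh.toLp

theorem coeFn_mulL {h : ℝ → ℂ} (hh : MemLp h ∞ (leb p q)) (f : L2 p q E) :
    mulL hh f =ᵐ[leb p q] fun x => h x • f x := by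
  filter_upwards [ContinuousLinearMap.coeFn_holder (r := 2) (ContinuousLinearMap.lsmul ℂ ℂ)
    hh.toLp f, hh.coeFn_toLp] with x h1 h2
  refine h1.trans ?_
  rw [h2]; rfl

/-- Restriction of `L²` functions to a smaller interval. -/
def restrictL {q' : ℝ} (h : leb p q' ≤ leb p q) : L2 p q E →L[ℂ] L2 p q' E :=
  LinearMap.mkContinuous
    { toFun := fun f => ((Lp.memLp f).mono_measure h).toLp
      map_add' := fun f g => by
        refine Lp.ext ?_
        filter_upwards [((Lp.memLp (f + g)).mono_measure h).coeFn_toLp,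
          ((Lp.memLp f).mono_measure h).coeFn_toLp, ((Lp.memLp g).mono_measure h).coeFn_toLp,
          ae_mono h (Lp.coeFn_add f g), Lp.coeFn_add ((Lp.memLp f).mono_measure h).toLp
            ((Lp.memLp g).mono_measure h).toLp] with x h1 h2 h3 h4 h5
        rw [h1, h4, h5, Pi.add_apply, Pi.add_apply, h2, h3]
      map_smul' := fun c f => by
        refine Lp.ext ?_
        filter_upwards [((Lp.memLp (c • f)).mono_measure h).coeFn_toLp,
          ((Lp.memLp f).mono_measure h).coeFn_toLp, ae_mono h (Lp.coeFn_smul c f),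
          Lp.coeFn_smul c ((Lp.memLp f).mono_measure h).toLp] with x h1 h2 h3 h4
        rw [h1, h3, RingHom.id_apply, h4, Pi.smul_apply, Pi.smul_apply, h2] }
    1 (fun f => by
      rw [one_mul]
      change ‖((Lp.memLp f).mono_measure h).toLp‖ ≤ _
      rw [Lp.norm_toLp, Lp.norm_def]
      exact ENNReal.toReal_mono (Lp.memLp f).2.ne (eLpNorm_mono_measure _ h))

theorem coeFn_restrictL {q' : ℝ} (h : leb p q' ≤ leb p q) (f : L2 p q E) :
    restrictL h f =ᵐ[leb p q'] f :=
  ((Lp.memLp f).mono_measure h).coeFn_toLp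

/-- Extension of `L²` functions by zero to a larger interval. -/
def extendL {q' : ℝ} (h : q' ≤ q) : L2 p q' E →L[ℂ] L2 p q E :=
  LinearMap.mkContinuous
    { toFun := fun f => (memLp_indicator h f).toLp
      map_add' := fun f g => by
        refine Lp.ext ?_
        filter_upwards [(memLp_indicator h (f + g)).coeFn_toLp, (memLp_indicator h f).coeFn_toLp,
          (memLp_indicator h g).coeFn_toLp, ae_indicator (Lp.coeFn_add f g),
          Lp.coeFn_add (memLp_indicator h f).toLp (memLp_indicator h g).toLp] with x h1 h2 h3 h4 h5
        rw [h1, h5, Pi.add_apply, h2, h3]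
        by_cases hx : x ∈ Ioo p q'
        · simp only [indicator_of_mem hx, h4 hx, Pi.add_apply]
        · simp [indicator_of_notMem hx]
      map_smul' := fun c f => by
        refine Lp.ext ?_
        filter_upwards [(memLp_indicator h (c • f)).coeFn_toLp, (memLp_indicator h f).coeFn_toLp,
          ae_indicator (Lp.coeFn_smul c f),
          Lp.coeFn_smul c (memLp_indicator h f).toLp] with x h1 h2 h3 h4
        rw [h1, RingHom.id_apply, h4, Pi.smul_apply, h2]
        by_cases hx : x ∈ Ioo p q'
        · simp [indicator_of_mem hx, h3 hx]
        · simp [indicator_of_notMem hx] }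
    1 (fun f => by
      rw [one_mul]
      change ‖(memLp_indicator h f).toLp‖ ≤ _
      rw [Lp.norm_toLp, Lp.norm_def, eLpNorm_indicator_eq_eLpNorm_restrict measurableSet_Ioo,
        Measure.restrict_restrict_of_subset (Ioo_subset_Ioo_right h)])

theorem coeFn_extendL {q' : ℝ} (h : q' ≤ q) (f : L2 p q' E) :
    extendL h f =ᵐ[leb p q] (Ioo p q').indicator f :=
  (memLp_indicator h f).coeFn_toLp

end Operators

section Volterra

variable {E : Type} [NormedAddCommGroup E] [NormedSpace ℂ E] {p q : ℝ}

/-- The Volterra operator `X ↦ ∫ₚˣ N X`, for an operator `N` on `L²`. -/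
def volterra (N : L2 p q E →L[ℂ] L2 p q E) : (ℝ →ᵇ E) →L[ℂ] (ℝ →ᵇ E) :=
  (prim p q).comp (N.comp (toL2 p q))

theorem norm_volterra_pow_apply_le {N : L2 p q E →L[ℂ] L2 p q E} {M : ℝ} (hM : 0 ≤ M)
    (hN : ∀ f, ∀ᵐ t ∂leb p q, ‖N f t‖ ≤ M * ‖f t‖) (n : ℕ) (X : ℝ →ᵇ E) :
    ∀ x ∈ Icc p q, ‖(volterra N ^ n) X x‖ ≤ (M * (x - p)) ^ n / n.factorial * ‖X‖ := by
  induction n with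
  | zero => intro x _; simpa using X.norm_coe_le_norm x
  | succ n ih =>
    intro x hx
    rw [pow_succ']
    set Y := (volterra N ^ n) X with hY
    change ‖prim p q (N (toL2 p q Y)) x‖ ≤ _
    have hg : Continuous fun t => M * ((M * (t - p)) ^ n / n.factorial * ‖X‖) := by fun_prop
    have hd : ∀ t, HasDerivAt (fun t => (M * (t - p)) ^ (n + 1) / (n + 1).factorial * ‖X‖)
        (M * ((M * (t - p)) ^ n / n.factorial * ‖X‖)) t := by
      intro t
      have h0 : HasDerivAt (fun t => M * (t - p)) M t := by
        simpa using ((hasDerivAt_id t).sub_const p).const_mul M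
      refine (((h0.pow (n + 1)).div_const _).mul_const _).congr_deriv ?_
      have : (n.factorial : ℝ) ≠ 0 := by positivity
      have : (n + 1 : ℝ) ≠ 0 := by positivity
      simp only [Nat.factorial_succ, Nat.cast_mul, Nat.cast_add, Nat.cast_one, Nat.add_sub_cancel]
      field_simp
    calc ‖prim p q (N (toL2 p q Y)) x‖
        ≤ ∫ t in p..x, M * ((M * (t - p)) ^ n / n.factorial * ‖X‖) ∂leb p q := by
          refine intervalIntegral.norm_integral_le_of_norm_le hx.1 ?_
            (hg.intervalIntegrable _ _)
          filter_upwards [hN (toL2 p q Y), coeFn_toL2 (p := p) (q := q) Y,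
            ae_restrict_mem measurableSet_Ioo] with t h1 h2 h3 _
          rw [h2] at h1
          exact h1.trans (mul_le_mul_of_nonneg_left (ih t (Ioo_subset_Icc_self h3)) hM)
      _ = (M * (x - p)) ^ (n + 1) / (n + 1).factorial * ‖X‖ := by
          rw [intervalIntegral_leb _ hx, intervalIntegral.integral_eq_sub_of_hasDerivAt
            (fun t _ => hd t) (hg.intervalIntegrable _ _)]
          simp

/-- A Volterra equation of the second kind is uniquely solvable: the iterates of the Volterra
operator are bounded by `(M (q - p))ⁿ / n!`, so that some power is a contraction. -/
theorem isUnit_one_sub_volterra [CompleteSpace E] (hpq : p ≤ q) {N : L2 p q E →L[ℂ] L2 p q E}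
    {M : ℝ} (hM : 0 ≤ M) (hN : ∀ f, ∀ᵐ t ∂leb p q, ‖N f t‖ ≤ M * ‖f t‖) :
    IsUnit (1 - volterra N) := by
  have hlim := FloorSemiring.tendsto_pow_div_factorial_atTop (M * (q - p))
  obtain ⟨n, hn, hn0⟩ := ((hlim.eventually (gt_mem_nhds one_pos)).and
    (Filter.eventually_gt_atTop 0)).exists
  have hlt : ‖volterra N ^ n‖ < 1 := by
    refine lt_of_le_of_lt (ContinuousLinearMap.opNorm_le_bound _ ?_ fun X => ?_) hn
    · have : 0 ≤ q - p := sub_nonneg.2 hpq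
      positivity
    · have h0 : 0 ≤ q - p := sub_nonneg.2 hpq
      rw [BoundedContinuousFunction.norm_le (by positivity)]
      obtain ⟨m, rfl⟩ := Nat.exists_eq_succ_of_ne_zero hn0.ne'
      -- the values outside `[p, q]` are those at the end points
      have hin := norm_volterra_pow_apply_le hM hN (m + 1) X
      have hle : ∀ x ∈ Icc p q, ‖(volterra N ^ (m + 1)) X x‖ ≤
          (M * (q - p)) ^ (m + 1) / (m + 1).factorial * ‖X‖ := fun x hx => by
        refine (hin x hx).trans ?_
        have h1 : 0 ≤ x - p := sub_nonneg.2 hx.1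
        have h2 : x - p ≤ q - p := by linarith [hx.2]
        gcongr
      intro x
      rcases le_total x p with hx | hx
      · have : (volterra N ^ (m + 1)) X x = 0 := by
          rw [pow_succ']; exact prim_of_le _ hx
        rw [Nat.succ_eq_add_one, this, norm_zero]
        positivity
      rcases le_total x q with hx' | hx'
      · exact hle x ⟨hx, hx'⟩
      · have : (volterra N ^ (m + 1)) X x = (volterra N ^ (m + 1)) X q := by
          rw [pow_succ']; exact prim_of_ge _ hpq hx'
        rw [Nat.succ_eq_add_one, this]
        exact hle q ⟨hpq, le_rfl⟩
  have hu : IsUnit (1 - volterra N ^ n) := isUnit_one_sub_of_norm_lt_one hlt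
  have hcomm : Commute (1 - volterra N) (∑ i ∈ Finset.range n, volterra N ^ i) :=
    ((Commute.one_left _).sub_left (Commute.sum_right _ _ _ fun i _ => Commute.self_pow _ i))
  rw [← mul_neg_geom_sum] at hu
  exact (hcomm.isUnit_mul_iff.1 hu).1

end Volterra

/-! ### Elements of `H¹` and their derivatives -/

namespace H1Van

variable {p q : ℝ} {Z : Set ℝ}

theorem prim_dx_eqOn (hpq : p < q) (f : H1Van p q Z) {w : ℝ → ℂ} (hw : IsContRep p q f.fn w)
    (hp : w p = 0) : EqOn w (prim p q f.dx) (Icc p q) := by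
  obtain ⟨c, hc⟩ := f.isWeakDeriv.exists_ae_eq_prim hpq f.fn.integrable
  have h := eqOn_Icc_of_ae_eq hpq hw.cont
    (continuous_const.add (prim p q f.dx).continuous).continuousOn (hw.ae_eq.symm.trans hc)
  have hc0 : c = 0 := by
    have := h (left_mem_Icc.2 hpq.le)
    simpa [hp] using this.symm
  intro x hx
  rw [h hx, hc0]
  exact zero_add _

/-- An element of `H¹` that vanishes at `p` is the primitive of its derivative. -/
theorem fn_ae_eq_prim (hpq : p < q) (f : H1Van p q Z) : f.fn =ᵐ[leb p q] prim p q f.dx := by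
  obtain ⟨w, hw, hw0⟩ := f.2.2
  filter_upwards [hw.ae_eq, ae_restrict_mem measurableSet_Ioo] with x hx hx'
  exact hx.trans (prim_dx_eqOn hpq f hw (hw0 p (mem_insert _ _)) (Ioo_subset_Icc_self hx'))

theorem fn_eq (hpq : p < q) (f : H1Van p q Z) : f.fn = toL2 p q (prim p q f.dx) :=
  Lp.ext ((fn_ae_eq_prim hpq f).trans (coeFn_toL2 _).symm)

theorem prim_dx_eq_zero (hpq : p < q) (f : H1Van p q Z) {x : ℝ} (hx : x ∈ Z)
    (hx' : x ∈ Icc p q) : prim p q f.dx x = 0 := by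
  obtain ⟨w, hw, hw0⟩ := f.2.2
  rw [← prim_dx_eqOn hpq f hw (hw0 p (mem_insert _ _)) hx', hw0 x (mem_insert_of_mem _ hx)]

/-- The derivative as a bounded operator. -/
def dxL : H1Van p q Z →L[ℂ] L2 p q ℂ :=
  (⟨dx, fun _ => rfl⟩ : H1Van p q Z →ₗᵢ[ℂ] L2 p q ℂ).toContinuousLinearMap

/-- The inclusion `H¹ ⊂ L²` as a bounded operator; its boundedness is the Poincaré inequality. -/
def fnL : H1Van p q Z →L[ℂ] L2 p q ℂ :=
  (toL2 p q).comp ((prim p q).comp dxL)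

theorem fnL_apply (hpq : p < q) (f : H1Van p q Z) : fnL f = f.fn := (fn_eq hpq f).symm

theorem mem_h1VanSub (hpq : p < q) {g : L2 p q ℂ} (h : ∀ x ∈ Z, prim p q g x = 0) :
    (toL2 p q (prim p q g), g) ∈ h1VanSub p q Z := by
  refine ⟨(isWeakDeriv_prim hpq g).congr (coeFn_toL2 _) Filter.EventuallyEq.rfl,
    prim p q g, ⟨(prim p q g).continuous.continuousOn, coeFn_toL2 _⟩, ?_⟩
  rintro x (rfl | hx)
  · exact prim_left g
  · exact h x hx

variable {Y : Type} [NormedAddCommGroup Y] [NormedSpace ℂ Y]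

/-- A bounded family of `L²` functions whose primitives vanish on `Z` is the family of derivatives
of a bounded family in `H¹`. -/
def lift (hpq : p < q) (D : Y →L[ℂ] L2 p q ℂ) (h : ∀ y, ∀ x ∈ Z, prim p q (D y) x = 0) :
    Y →L[ℂ] H1Van p q Z :=
  LinearMap.mkContinuous
    { toFun := fun y => (⟨_, mem_h1VanSub hpq (h y)⟩ : h1VanSub p q Z)
      map_add' := fun y y' => dx_injective (map_add D y y')
      map_smul' := fun c y => dx_injective (map_smul D c y) }
    ‖D‖ (fun y => D.le_opNorm y)

end H1Van

/-- The element of `H¹_L` with a given derivative. -/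
def mkLeft {p q : ℝ} (hpq : p < q) : L2 p q ℂ →L[ℂ] H1Left p q :=
  H1Van.lift hpq (ContinuousLinearMap.id ℂ _) (fun _ _ hx => absurd hx (notMem_empty _))

theorem prim_restrictL {p q q' : ℝ} (h : q' ≤ q) (hm : leb p q' ≤ leb p q) (g : L2 p q ℂ) {x : ℝ}
    (hx : x ∈ Icc p q') : prim p q' (restrictL hm g) x = prim p q g x := by
  rw [prim_eq g ⟨hx.1, hx.2.trans h⟩, ← intervalIntegral_leb _ hx, prim_apply]
  refine intervalIntegral.integral_congr_ae ?_
  filter_upwards [coeFn_restrictL hm g] with t ht _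
  exact ht

namespace Params

variable (P : Params)

theorem hβ : 0 < P.β := P.hα.trans P.hαβ

theorem hβL : P.β < P.L := P.hβγ.trans P.hγL

end Params

/-- The restriction `H¹₀(0, L) → H¹_L(0, β)`. -/
def restrictH1 (P : Params) : H1Zero 0 P.L →L[ℂ] H1Left 0 P.β :=
  (mkLeft P.hβ).comp ((restrictL leb_mono).comp H1Van.dxL)

theorem dx_restrictH1 (P : Params) (f : H1Zero 0 P.L) :
    (restrictH1 P f).dx =ᵐ[leb 0 P.β] f.dx :=
  coeFn_restrictL leb_mono f.dx

theorem fn_restrictH1 (P : Params) (f : H1Zero 0 P.L) :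
    (restrictH1 P f).fn =ᵐ[leb 0 P.β] f.fn := by
  filter_upwards [H1Van.fn_ae_eq_prim P.hβ (restrictH1 P f),
    ae_mono leb_mono (H1Van.fn_ae_eq_prim P.hL f), ae_restrict_mem measurableSet_Ioo]
    with x h1 h2 h3
  rw [h1, h2]
  exact prim_restrictL P.hβL.le leb_mono f.dx (Ioo_subset_Icc_self h3)

theorem eq_restrictH1 (P : Params) {e : H1Left 0 P.β} {f : H1Zero 0 P.L}
    (h : e.fn =ᵐ[leb 0 P.β] f.fn) : e = restrictH1 P f := by
  rw [← sub_eq_zero]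
  refine H1Van.fn_eq_zero ?_
  rw [map_sub, sub_eq_zero]
  exact Lp.ext (h.trans (fn_restrictH1 P f).symm)

/-! ### The topology of the energy space -/

namespace State

variable {P : Params}

theorem norm_sq_eq (U : State P) : ‖U‖ ^ 2 = P.a * ‖U.u‖ ^ 2 + ‖U.v‖ ^ 2 + ‖U.y‖ ^ 2
    + ‖U.z‖ ^ 2 + P.τ * |P.κ₂| * ‖U.η‖ ^ 2 := by
  have h := inner_self_coe U
  rw [inner_def] at h
  simp only [inner_self_coe] at h
  exact_mod_cast h.symm

/-- The energy space is, up to equivalence of norms, the product of its five factors. -/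
def prodEquiv (P : Params) :
    State P ≃L[ℂ] H1Zero 0 P.L × L2 0 P.L ℂ × H1Zero 0 P.L × L2 0 P.L ℂ × P.W :=
  LinearEquiv.toContinuousLinearEquivOfBounds
    { toFun := fun U => (U.u, U.v, U.y, U.z, U.η)
      invFun := fun X => X
      map_add' := fun _ _ => rfl
      map_smul' := fun _ _ => rfl
      left_inv := fun _ => rfl
      right_inv := fun _ => rfl }
    (Real.sqrt (P.a⁻¹ + 1 + (P.τ * |P.κ₂|)⁻¹))
    (Real.sqrt (P.a + 3 + P.τ * |P.κ₂|))
    (fun U => by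
      have ha := P.ha
      have hk : 0 < P.τ * |P.κ₂| := mul_pos P.hτ (abs_pos.2 P.hκ₂)
      have hn := norm_sq_eq U
      set C := P.a⁻¹ + 1 + (P.τ * |P.κ₂|)⁻¹ with hC
      have hC0 : 0 ≤ C := by positivity
      have key : ∀ r t : ℝ, 0 ≤ r → 0 < t → t⁻¹ ≤ C → t * r ^ 2 ≤ ‖U‖ ^ 2 →
          r ≤ Real.sqrt C * ‖U‖ := fun r t hr ht htC h => by
        refine le_of_sq_le_sq ?_ (by positivity)
        rw [mul_pow, Real.sq_sqrt hC0]
        calc r ^ 2 = t⁻¹ * (t * r ^ 2) := by field_simp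
          _ ≤ C * ‖U‖ ^ 2 := by gcongr
      have p1 : 0 ≤ P.a * ‖U.u‖ ^ 2 := by positivity
      have p2 : 0 ≤ ‖U.v‖ ^ 2 := by positivity
      have p3 : 0 ≤ ‖U.y‖ ^ 2 := by positivity
      have p4 : 0 ≤ ‖U.z‖ ^ 2 := by positivity
      have p5 : 0 ≤ P.τ * |P.κ₂| * ‖U.η‖ ^ 2 := by positivity
      have q1 : 0 < P.a⁻¹ := by positivity
      have q2 : 0 < (P.τ * |P.κ₂|)⁻¹ := by positivity
      change ‖(U.u, U.v, U.y, U.z, U.η)‖ ≤ _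
      simp only [Prod.norm_def, max_le_iff]
      refine ⟨key _ P.a (norm_nonneg _) ha ?_ ?_, key _ 1 (norm_nonneg _) one_pos ?_ ?_,
        key _ 1 (norm_nonneg _) one_pos ?_ ?_, key _ 1 (norm_nonneg _) one_pos ?_ ?_,
        key _ _ (norm_nonneg _) hk ?_ ?_⟩ <;> linarith)
    (fun X => by
      have ha := P.ha
      have hk : 0 < P.τ * |P.κ₂| := mul_pos P.hτ (abs_pos.2 P.hκ₂)
      refine le_of_sq_le_sq ?_ (by positivity)
      rw [mul_pow, Real.sq_sqrt (by positivity)]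
      obtain ⟨u, v, y, z, η⟩ := X
      have h5 : ‖u‖ ≤ ‖(u, v, y, z, η)‖ ∧ ‖v‖ ≤ ‖(u, v, y, z, η)‖ ∧ ‖y‖ ≤ ‖(u, v, y, z, η)‖ ∧
          ‖z‖ ≤ ‖(u, v, y, z, η)‖ ∧ ‖η‖ ≤ ‖(u, v, y, z, η)‖ := by
        have := le_refl ‖(u, v, y, z, η)‖
        conv at this => lhs; simp only [Prod.norm_def]
        simpa only [max_le_iff] using this
      set r := ‖(u, v, y, z, η)‖
      obtain ⟨h1, h2, h3, h4, h5⟩ := h5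
      refine (norm_sq_eq (P := P) (u, v, y, z, η)).trans_le ?_
      change P.a * ‖u‖ ^ 2 + ‖v‖ ^ 2 + ‖y‖ ^ 2 + ‖z‖ ^ 2 + P.τ * |P.κ₂| * ‖η‖ ^ 2 ≤ _
      calc _ ≤ P.a * r ^ 2 + r ^ 2 + r ^ 2 + r ^ 2 + P.τ * |P.κ₂| * r ^ 2 := by gcongr
        _ = _ := by ring)

/-- The component `u` as a bounded operator. -/
def uL (P : Params) : State P →L[ℂ] H1Zero 0 P.L :=
  (ContinuousLinearMap.fst ℂ _ _).comp (prodEquiv P).toContinuousLinearMap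

/-- The components `(v, y, z, η)` as a bounded operator. -/
def tailL (P : Params) : State P →L[ℂ] L2 0 P.L ℂ × H1Zero 0 P.L × L2 0 P.L ℂ × P.W :=
  (ContinuousLinearMap.snd ℂ _ _).comp (prodEquiv P).toContinuousLinearMap

/-- The component `v` as a bounded operator. -/
def vL (P : Params) : State P →L[ℂ] L2 0 P.L ℂ :=
  (ContinuousLinearMap.fst ℂ _ _).comp (tailL P)

/-- The component `y` as a bounded operator. -/
def yL (P : Params) : State P →L[ℂ] H1Zero 0 P.L :=
  (ContinuousLinearMap.fst ℂ _ _).comp ((ContinuousLinearMap.snd ℂ _ _).comp (tailL P))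

/-- The component `z` as a bounded operator. -/
def zL (P : Params) : State P →L[ℂ] L2 0 P.L ℂ :=
  (ContinuousLinearMap.fst ℂ _ _).comp ((ContinuousLinearMap.snd ℂ _ _).comp
    ((ContinuousLinearMap.snd ℂ _ _).comp (tailL P)))

/-- The component `η` as a bounded operator. -/
def ηL (P : Params) : State P →L[ℂ] P.W :=
  (ContinuousLinearMap.snd ℂ _ _).comp ((ContinuousLinearMap.snd ℂ _ _).comp
    ((ContinuousLinearMap.snd ℂ _ _).comp (tailL P)))

end State

/-! ### The first-order system -/

/-- The values `(u, S, y, y_x)` of the first-order system. -/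
abbrev Phase : Type := ℂ × ℂ × ℂ × ℂ

namespace Phase

/-- The component `u`. -/
def π₁ : Phase →L[ℂ] ℂ := ContinuousLinearMap.fst ℂ _ _
/-- The component `S`. -/
def π₂ : Phase →L[ℂ] ℂ := (ContinuousLinearMap.fst ℂ _ _).comp (ContinuousLinearMap.snd ℂ _ _)
/-- The component `y`. -/
def π₃ : Phase →L[ℂ] ℂ := (ContinuousLinearMap.fst ℂ _ _).comp
  ((ContinuousLinearMap.snd ℂ _ _).comp (ContinuousLinearMap.snd ℂ _ _))
/-- The component `y_x`. -/
def π₄ : Phase →L[ℂ] ℂ := (ContinuousLinearMap.snd ℂ _ _).comp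
  ((ContinuousLinearMap.snd ℂ _ _).comp (ContinuousLinearMap.snd ℂ _ _))

@[simp] theorem π₁_apply (X : Phase) : π₁ X = X.1 := rfl
@[simp] theorem π₂_apply (X : Phase) : π₂ X = X.2.1 := rfl
@[simp] theorem π₃_apply (X : Phase) : π₃ X = X.2.2.1 := rfl
@[simp] theorem π₄_apply (X : Phase) : π₄ X = X.2.2.2 := rfl

end Phase

open Phase

/-- The damping symbol `k = κ₁ + κ₂ e^{-irτ}`. -/
def symb (P : Params) (r : ℝ) : ℂ := P.κ₁ + P.κ₂ * Complex.exp (-(Complex.I * r * P.τ))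

/-- The coefficient `m = a + i r k` of `u_x` in the stress on the damped part. -/
def stiff (P : Params) (r : ℝ) : ℂ := P.a + Complex.I * r * symb P r

theorem symb_re_pos {P : Params} (hH : P.HypH) (r : ℝ) : 0 < (symb P r).re := by
  have h1 : (Complex.exp (-(Complex.I * r * P.τ))).re = Real.cos (r * P.τ) := by
    have : -(Complex.I * r * P.τ) = ((-(r * P.τ) : ℝ) : ℂ) * Complex.I := by push_cast; ring
    rw [this, Complex.exp_ofReal_mul_I_re, Real.cos_neg]
  have h2 : (symb P r).re = P.κ₁ + P.κ₂ * Real.cos (r * P.τ) := by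
    rw [symb, Complex.add_re, Complex.ofReal_re, Complex.re_ofReal_mul, h1]
  have h3 : |P.κ₂ * Real.cos (r * P.τ)| ≤ |P.κ₂| := by
    rw [abs_mul]
    exact mul_le_of_le_one_right (abs_nonneg _) (Real.abs_cos_le_one _)
  rw [h2]
  linarith [neg_abs_le (P.κ₂ * Real.cos (r * P.τ)), hH.2.2]

theorem stiff_im (P : Params) (r : ℝ) : (stiff P r).im = r * (symb P r).re := by
  simp [stiff, mul_assoc]

theorem stiff_zero (P : Params) : stiff P 0 = P.a := by simp [stiff]

theorem stiff_ne_zero {P : Params} (hH : P.HypH) (r : ℝ) : stiff P r ≠ 0 := by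
  rcases eq_or_ne r 0 with rfl | hr
  · rw [stiff_zero]; exact_mod_cast P.ha.ne'
  · intro h
    have := stiff_im P r
    rw [h, Complex.zero_im] at this
    exact (mul_ne_zero hr (symb_re_pos hH r).ne') this.symm

namespace Params

variable (P : Params)

theorem measurable_b : Measurable P.b := measurable_const.indicator measurableSet_Ioo

theorem measurable_c : Measurable P.c := measurable_const.indicator measurableSet_Ioo

theorem norm_b_le (x : ℝ) : ‖P.b x‖ ≤ 1 := by
  rw [b]
  refine (norm_indicator_le_norm_self _ x).trans ?_
  simp

theorem norm_c_le (x : ℝ) : ‖P.c x‖ ≤ P.c₀ := by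
  rw [c]
  refine (norm_indicator_le_norm_self _ x).trans ?_
  simp [abs_of_pos P.hc₀]

theorem memLp_b : MemLp P.b ∞ (leb 0 P.L) :=
  memLp_top_of_bound P.measurable_b.aestronglyMeasurable 1 (Filter.Eventually.of_forall P.norm_b_le)

theorem memLp_c : MemLp P.c ∞ (leb 0 P.L) :=
  memLp_top_of_bound P.measurable_c.aestronglyMeasurable P.c₀
    (Filter.Eventually.of_forall P.norm_c_le)

theorem b_of_mem {x : ℝ} (hx : x ∈ Ioo 0 P.β) : P.b x = 1 := indicator_of_mem hx _

theorem b_of_notMem {x : ℝ} (hx : x ∉ Ioo 0 P.β) : P.b x = 0 := indicator_of_notMem hx _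

theorem c_of_mem {x : ℝ} (hx : x ∈ Ioo P.α P.γ) : P.c x = P.c₀ := indicator_of_mem hx _

theorem c_conj (x : ℝ) : (starRingEnd ℂ) (P.c x) = P.c x := by
  by_cases hx : x ∈ Ioo P.α P.γ
  · rw [P.c_of_mem hx, Complex.conj_ofReal]
  · rw [c, indicator_of_notMem hx, map_zero]

end Params

/-- Indicators of intervals are locally constant off the end points. -/
theorem indicator_Ioo_eventuallyEq {p q x : ℝ} (hp : x ≠ p) (hq : x ≠ q) (k : ℂ) :
    ∀ᶠ t in nhds x, (Ioo p q).indicator (fun _ => k) t = (Ioo p q).indicator (fun _ => k) x := by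
  by_cases hx : x ∈ Ioo p q
  · filter_upwards [isOpen_Ioo.mem_nhds hx] with t ht
    rw [indicator_of_mem hx, indicator_of_mem ht]
  · have hx' : x ∉ Icc p q := fun h => hx ⟨lt_of_le_of_ne h.1 hp.symm, lt_of_le_of_ne h.2 hq⟩
    filter_upwards [isClosed_Icc.isOpen_compl.mem_nhds hx'] with t ht
    rw [indicator_of_notMem hx, indicator_of_notMem fun h => ht (Ioo_subset_Icc_self h)]

section System

variable (P : Params) (r : ℝ)

/-- The part of the coefficient matrix that is present on the whole interval. -/
def matO : Phase →L[ℂ] Phase :=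
  ((P.a : ℂ)⁻¹ • π₂).prod ((-(r : ℂ) ^ 2 • π₁).prod (π₄.prod (-(r : ℂ) ^ 2 • π₃)))

/-- The change of the coefficient matrix on the damped part. -/
def matB : Phase →L[ℂ] Phase :=
  (((stiff P r)⁻¹ - (P.a : ℂ)⁻¹) • π₂).prod 0

/-- The coupling part of the coefficient matrix. -/
def matC : Phase →L[ℂ] Phase :=
  (0 : Phase →L[ℂ] ℂ).prod (((Complex.I * r) • π₃).prod
    ((0 : Phase →L[ℂ] ℂ).prod (-(Complex.I * r) • π₁)))

/-- The coefficient matrix of the first-order system: `u' = S / m`, `S' = -r² u + i r c y`,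
`y' = q`, `q' = -r² y - i r c u`, where `m = a + i r b k`. -/
def mat (x : ℝ) : Phase →L[ℂ] Phase := matO P r + P.b x • matB P r + P.c x • matC r

theorem mat_apply (x : ℝ) (X : Phase) : mat P r x X =
    (((P.a : ℂ)⁻¹ + P.b x * ((stiff P r)⁻¹ - (P.a : ℂ)⁻¹)) * X.2.1,
      -(r : ℂ) ^ 2 * X.1 + P.c x * (Complex.I * r * X.2.2.1), X.2.2.2,
      -(r : ℂ) ^ 2 * X.2.2.1 - P.c x * (Complex.I * r * X.1)) := by
  refine Prod.ext ?_ (Prod.ext ?_ (Prod.ext ?_ ?_)) <;>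
    simp [mat, matO, matB, matC] <;> ring

/-- The coefficient matrix as an operator on `L²`. -/
def sysL : L2 0 P.L Phase →L[ℂ] L2 0 P.L Phase :=
  (matO P r).compLpL 2 (leb 0 P.L) + (mulL P.memLp_b).comp ((matB P r).compLpL 2 (leb 0 P.L))
    + (mulL P.memLp_c).comp ((matC r).compLpL 2 (leb 0 P.L))

theorem coeFn_sysL (f : L2 0 P.L Phase) :
    sysL P r f =ᵐ[leb 0 P.L] fun x => mat P r x (f x) := by
  filter_upwards [Lp.coeFn_add ((matO P r).compLpL 2 (leb 0 P.L) f +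
      mulL P.memLp_b ((matB P r).compLpL 2 (leb 0 P.L) f))
      (mulL P.memLp_c ((matC r).compLpL 2 (leb 0 P.L) f)),
    Lp.coeFn_add ((matO P r).compLpL 2 (leb 0 P.L) f)
      (mulL P.memLp_b ((matB P r).compLpL 2 (leb 0 P.L) f)),
    (matO P r).coeFn_compLpL f, (matB P r).coeFn_compLpL f, (matC r).coeFn_compLpL f,
    coeFn_mulL P.memLp_b ((matB P r).compLpL 2 (leb 0 P.L) f),
    coeFn_mulL P.memLp_c ((matC r).compLpL 2 (leb 0 P.L) f)] with x h1 h2 h3 h4 h5 h6 h7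
  refine h1.trans ?_
  rw [Pi.add_apply, h2, Pi.add_apply, h3, h6, h7, h4, h5]
  rfl

theorem norm_sysL_le (f : L2 0 P.L Phase) : ∀ᵐ x ∂leb 0 P.L,
    ‖sysL P r f x‖ ≤ (‖matO P r‖ + ‖matB P r‖ + P.c₀ * ‖matC r‖) * ‖f x‖ := by
  filter_upwards [coeFn_sysL P r f] with x hx
  rw [hx]
  refine (mat P r x).le_of_opNorm_le ?_ _
  refine (norm_add₃_le).trans ?_
  rw [norm_smul, norm_smul]
  have h1 := mul_le_mul_of_nonneg_right (P.norm_b_le x) (norm_nonneg (matB P r))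
  have h2 := mul_le_mul_of_nonneg_right (P.norm_c_le x) (norm_nonneg (matC r))
  linarith

theorem isUnit_one_sub_volterra_sysL : IsUnit (1 - volterra (sysL P r)) :=
  isUnit_one_sub_volterra P.hL.le
    (by have := P.hc₀; positivity) (norm_sysL_le P r)

variable {P r} {X : ℝ →ᵇ Phase} {X₀ : Phase}

theorem integrable_mat (X : ℝ →ᵇ Phase) :
    Integrable (fun t => mat P r t (X t)) (leb 0 P.L) := by
  refine (sysL P r (toL2 0 P.L X)).integrable.congr ?_
  filter_upwards [coeFn_sysL P r (toL2 0 P.L X), coeFn_toL2 (p := 0) (q := P.L) X] with t h1 h2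
  rw [h1, h2]

theorem intervalIntegrable_mat (X : ℝ →ᵇ Phase) {x : ℝ} (hx : x ∈ Icc 0 P.L) :
    IntervalIntegrable (fun t => mat P r t (X t)) volume 0 x := by
  rw [intervalIntegrable_iff_integrableOn_Ioo_of_le hx.1]
  exact IntegrableOn.mono_set (integrable_mat X) (Ioo_subset_Ioo_right hx.2)

/-- The integral form of the homogeneous system. -/
theorem solution_eq (hX : X = BoundedContinuousFunction.const ℝ X₀ + volterra (sysL P r) X)
    {x : ℝ} (hx : x ∈ Icc 0 P.L) : X x = X₀ + ∫ t in 0..x, mat P r t (X t) := by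
  have h1 : X x = X₀ + prim 0 P.L (sysL P r (toL2 0 P.L X)) x := DFunLike.congr_fun hX x
  refine h1.trans ?_
  rw [prim_apply, ← intervalIntegral_leb _ hx]
  congr 1
  refine intervalIntegral.integral_congr_ae ?_
  filter_upwards [coeFn_sysL P r (toL2 0 P.L X), coeFn_toL2 (p := 0) (q := P.L) X] with t h1 h2 _
  rw [h1, h2]

theorem solution_comp_eq
    (hX : X = BoundedContinuousFunction.const ℝ X₀ + volterra (sysL P r) X)
    (T : Phase →L[ℂ] ℂ) {x : ℝ} (hx : x ∈ Icc 0 P.L) :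
    T (X x) = T X₀ + ∫ t in 0..x, T (mat P r t (X t)) := by
  rw [T.intervalIntegral_comp_comm (intervalIntegrable_mat X hx), ← map_add,
    ← solution_eq hX hx]

theorem solution_hasDerivAt
    (hX : X = BoundedContinuousFunction.const ℝ X₀ + volterra (sysL P r) X)
    (T : Phase →L[ℂ] ℂ) {x : ℝ} (hx : x ∈ Ioo 0 P.L \ {P.α, P.β, P.γ}) :
    HasDerivAt (fun t => T (X t)) (T (mat P r x (X x))) x := by
  obtain ⟨hx, hx'⟩ := hx
  simp only [mem_insert_iff, mem_singleton_iff, not_or] at hx'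
  have hev : (fun t => mat P r t (X t)) =ᶠ[nhds x] fun t => mat P r x (X t) := by
    filter_upwards [indicator_Ioo_eventuallyEq hx.1.ne' hx'.2.1 1,
      indicator_Ioo_eventuallyEq hx'.1 hx'.2.2 (P.c₀ : ℂ)] with t h1 h2
    have e1 : P.b t = P.b x := h1
    have e2 : P.c t = P.c x := h2
    rw [mat, mat, e1, e2]
  have hcont : ContinuousAt (fun t => mat P r t (X t)) x :=
    ((mat P r x).continuous.comp X.continuous).continuousAt.congr hev.symm
  have hmeas : AEStronglyMeasurable (fun t => mat P r t (X t)) volume := by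
    have hm : ∀ M : Phase →L[ℂ] Phase, AEStronglyMeasurable (fun t => M (X t)) volume := fun M =>
      (M.continuous.comp X.continuous).aestronglyMeasurable
    exact ((hm _).add (P.measurable_b.aestronglyMeasurable.smul (hm _))).add
      (P.measurable_c.aestronglyMeasurable.smul (hm _))
  have hd := intervalIntegral.integral_hasDerivAt_right
    (intervalIntegrable_mat (P := P) (r := r) X (Ioo_subset_Icc_self hx))
    hmeas.stronglyMeasurableAtFilter hcont
  have hd' : HasDerivAt X (mat P r x (X x)) x := by
    refine (hd.const_add X₀).congr_of_eventuallyEq ?_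
    filter_upwards [isOpen_Ioo.mem_nhds hx] with t ht
    exact solution_eq hX (Ioo_subset_Icc_self ht)
  exact (T.restrictScalars ℝ).hasFDerivAt.comp_hasDerivAt x hd'

end System

/-! ### Uniqueness for the boundary value problem -/

section Uniqueness

variable {P : Params} {r : ℝ} {X : ℝ →ᵇ Phase} {X₀ : Phase}

local notation "conj" => starRingEnd ℂ

/-- The derivative of `S ū + q ȳ` along a solution of the homogeneous system. -/
def fluxDeriv (P : Params) (r : ℝ) (X : ℝ →ᵇ Phase) (t : ℝ) : ℂ :=
  (π₂ (mat P r t (X t)) * conj (π₁ (X t)) + π₂ (X t) * conj (π₁ (mat P r t (X t))))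
    + (π₄ (mat P r t (X t)) * conj (π₃ (X t)) + π₄ (X t) * conj (π₃ (mat P r t (X t))))

theorem fluxDeriv_integrable : Integrable (fluxDeriv P r X) (leb 0 P.L) := by
  have h1 : ∀ T : Phase →L[ℂ] ℂ, Integrable (fun t => T (mat P r t (X t))) (leb 0 P.L) :=
    fun T => T.integrable_comp (integrable_mat X)
  have h2 : ∀ T : Phase →L[ℂ] ℂ, Integrable (fun t => conj (T (mat P r t (X t)))) (leb 0 P.L) :=
    fun T => Complex.conjCLE.toContinuousLinearMap.integrable_comp (h1 T)
  have hb : ∀ (T : Phase →L[ℂ] ℂ) (t : ℝ), ‖T (X t)‖ ≤ ‖T‖ * ‖X‖ := fun T t =>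
    T.le_opNorm_of_le (X.norm_coe_le_norm t)
  have hc : ∀ T : Phase →L[ℂ] ℂ, Continuous fun t => T (X t) := fun T =>
    T.continuous.comp X.continuous
  have h3 : ∀ T T' : Phase →L[ℂ] ℂ,
      Integrable (fun t => T (mat P r t (X t)) * conj (T' (X t))) (leb 0 P.L) := fun T T' =>
    (h1 T).mul_bdd (c := ‖T'‖ * ‖X‖) (Complex.continuous_conj.comp (hc T')).aestronglyMeasurable
      (Filter.Eventually.of_forall fun t => by
        rw [RCLike.norm_conj]; exact hb T' t)
  have h4 : ∀ T T' : Phase →L[ℂ] ℂ,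
      Integrable (fun t => T (X t) * conj (T' (mat P r t (X t)))) (leb 0 P.L) := fun T T' =>
    (h2 T').bdd_mul (c := ‖T‖ * ‖X‖) (hc T).aestronglyMeasurable
      (Filter.Eventually.of_forall (hb T))
  exact ((h3 _ _).add (h4 _ _)).add ((h3 _ _).add (h4 _ _))

theorem hasDerivAt_mul_conj {f g : ℝ → ℂ} {f' g' : ℂ} {x : ℝ} (hf : HasDerivAt f f' x)
    (hg : HasDerivAt g g' x) :
    HasDerivAt (fun t => f t * conj (g t)) (f' * conj (g x) + f x * conj g') x :=
  hf.mul (Complex.conjCLE.toContinuousLinearMap.hasFDerivAt.comp_hasDerivAt x hg)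

theorem integral_fluxDeriv
    (hX : X = BoundedContinuousFunction.const ℝ X₀ + volterra (sysL P r) X) :
    ∫ t in 0..P.L, fluxDeriv P r X t =
      (π₂ (X P.L) * conj (π₁ (X P.L)) + π₄ (X P.L) * conj (π₃ (X P.L))) -
        (π₂ (X 0) * conj (π₁ (X 0)) + π₄ (X 0) * conj (π₃ (X 0))) := by
  have hc : ∀ T : Phase →L[ℂ] ℂ, Continuous fun t => T (X t) := fun T =>
    T.continuous.comp X.continuous
  refine integral_eq_of_hasDerivAt_off_countable_of_le
    (fun t => π₂ (X t) * conj (π₁ (X t)) + π₄ (X t) * conj (π₃ (X t))) _ P.hL.le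
    (toFinite {P.α, P.β, P.γ}).countable ?_ ?_ ?_
  · exact (((hc π₂).mul (Complex.continuous_conj.comp (hc π₁))).add
      ((hc π₄).mul (Complex.continuous_conj.comp (hc π₃)))).continuousOn
  · intro x hx
    exact (hasDerivAt_mul_conj (solution_hasDerivAt hX π₂ hx) (solution_hasDerivAt hX π₁ hx)).add
      (hasDerivAt_mul_conj (solution_hasDerivAt hX π₄ hx) (solution_hasDerivAt hX π₃ hx))
  · rw [intervalIntegrable_iff_integrableOn_Ioo_of_le P.hL.le]
    exact fluxDeriv_integrable

/-- The coupling cancels in the imaginary part of the flux derivative; only the dissipation of the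
damped part is left. -/
theorem fluxDeriv_im (t : ℝ) : (fluxDeriv P r X t).im =
    (Ioo 0 P.β).indicator (fun t =>
      (stiff P r).im / Complex.normSq (stiff P r) * Complex.normSq (π₂ (X t))) t := by
  have hd : ∀ d S : ℂ, (S * conj (d * S)).im = -d.im * Complex.normSq S := by
    intro d S
    simp only [map_mul, Complex.mul_im, Complex.mul_re, Complex.conj_re, Complex.conj_im,
      Complex.normSq_apply]
    ring
  obtain ⟨c', hc'⟩ : ∃ c' : ℝ, P.c t = c' := Complex.conj_eq_iff_real.1 (P.c_conj t)
  have h1 : (fluxDeriv P r X t).im =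
      -((P.a : ℂ)⁻¹ + P.b t * ((stiff P r)⁻¹ - (P.a : ℂ)⁻¹)).im * Complex.normSq (π₂ (X t)) := by
    rw [fluxDeriv, mat_apply, hc', ← hd]
    generalize (P.a : ℂ)⁻¹ + P.b t * ((stiff P r)⁻¹ - (P.a : ℂ)⁻¹) = d
    simp only [π₁_apply, π₂_apply, π₃_apply, π₄_apply, Complex.add_im, Complex.sub_im,
      Complex.mul_im, Complex.mul_re, Complex.conj_re, Complex.conj_im, Complex.add_re,
      Complex.sub_re, Complex.neg_re, Complex.neg_im, Complex.I_re, Complex.I_im,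
      Complex.ofReal_re, Complex.ofReal_im, map_mul, pow_two]
    ring
  rw [h1]
  by_cases ht : t ∈ Ioo 0 P.β
  · rw [indicator_of_mem ht, P.b_of_mem ht, one_mul, add_sub_cancel, Complex.inv_im]
    ring
  · rw [indicator_of_notMem ht, P.b_of_notMem ht, zero_mul, add_zero, ← Complex.ofReal_inv,
      Complex.ofReal_im]
    ring

/-- With homogeneous boundary values the stress vanishes on the damped part. -/
theorem stress_eq_zero (hH : P.HypH) (hr : r ≠ 0)
    (hX : X = BoundedContinuousFunction.const ℝ X₀ + volterra (sysL P r) X)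
    (hu0 : π₁ (X 0) = 0) (hy0 : π₃ (X 0) = 0) (huL : π₁ (X P.L) = 0) (hyL : π₃ (X P.L) = 0) :
    ∀ x ∈ Icc 0 P.β, π₂ (X x) = 0 := by
  have h := integral_fluxDeriv hX
  rw [hu0, hy0, huL, hyL] at h
  simp only [map_zero, mul_zero, add_zero, sub_zero] at h
  have h2 : ∫ t in 0..P.L, (fluxDeriv P r X t).im = 0 := by
    have hi : IntervalIntegrable (fluxDeriv P r X) volume 0 P.L := by
      rw [intervalIntegrable_iff_integrableOn_Ioo_of_le P.hL.le]
      exact fluxDeriv_integrable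
    have := Complex.imCLM.intervalIntegral_comp_comm hi
    rw [h] at this
    simpa using this
  simp only [fluxDeriv_im] at h2
  rw [intervalIntegral.integral_of_le P.hL.le, integral_Ioc_eq_integral_Ioo,
    setIntegral_indicator measurableSet_Ioo,
    inter_eq_right.2 (Ioo_subset_Ioo_right P.hβL.le), integral_const_mul] at h2
  have hne : (stiff P r).im / Complex.normSq (stiff P r) ≠ 0 := by
    refine div_ne_zero ?_ (Complex.normSq_pos.2 (stiff_ne_zero hH r)).ne'
    rw [stiff_im]
    exact mul_ne_zero hr (symb_re_pos hH r).ne'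
  have h3 := (mul_eq_zero.1 h2).resolve_left hne
  have hcont : Continuous fun t => Complex.normSq (π₂ (X t)) :=
    Complex.continuous_normSq.comp (π₂.continuous.comp X.continuous)
  have hint : IntegrableOn (fun t => Complex.normSq (π₂ (X t))) (Ioo 0 P.β) :=
    (hcont.continuousOn.integrableOn_Icc).mono_set Ioo_subset_Icc_self
  rw [setIntegral_eq_zero_iff_of_nonneg_ae
    (Filter.Eventually.of_forall fun t => Complex.normSq_nonneg _) hint] at h3
  have h4 := eqOn_Icc_of_ae_eq P.hβ hcont.continuousOn
    (continuousOn_const (c := (0 : ℝ))) h3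
  exact fun x hx => Complex.normSq_eq_zero.1 (h4 hx)

/-- If the stress vanishes on the damped part, then so do `u` and, through the coupling on
`(α, β)`, also `y`; as `y` solves a harmonic oscillator equation on `(0, β)`, all initial values
vanish. -/
theorem initial_eq_zero_of_stress_eq_zero (hr : r ≠ 0)
    (hX : X = BoundedContinuousFunction.const ℝ X₀ + volterra (sysL P r) X)
    (hu0 : π₁ (X 0) = 0) (hy0 : π₃ (X 0) = 0) (hS : ∀ x ∈ Icc 0 P.β, π₂ (X x) = 0) :
    X 0 = 0 := by
  have hX0 : X 0 = X₀ := by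
    rw [solution_eq hX (left_mem_Icc.2 P.hL.le), intervalIntegral.integral_same, add_zero]
  have hβL := P.hβL
  have hu : ∀ x ∈ Icc 0 P.β, π₁ (X x) = 0 := by
    intro x hx
    rw [solution_comp_eq hX π₁ ⟨hx.1, hx.2.trans hβL.le⟩, ← hX0, hu0, zero_add]
    refine intervalIntegral.integral_zero_ae (Filter.Eventually.of_forall fun t ht => ?_)
    rw [uIoc_of_le hx.1] at ht
    have : (X t).2.1 = 0 := hS t ⟨ht.1.le, ht.2.trans hx.2⟩
    rw [mat_apply, π₁_apply, this, mul_zero]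
  have hαβ := P.hαβ
  have hα := P.hα
  have hβγ := P.hβγ
  have hγL := P.hγL
  have hy : ∀ x ∈ Ioo P.α P.β, π₃ (X x) = 0 := by
    intro x hx
    have hx0 : 0 < x := hα.trans hx.1
    have hd := solution_hasDerivAt hX π₂ (x := x) ⟨⟨hx0, hx.2.trans hβL⟩, by
      simp only [mem_insert_iff, mem_singleton_iff, not_or]
      exact ⟨hx.1.ne', hx.2.ne, (hx.2.trans hβγ).ne⟩⟩
    have h0 : HasDerivAt (fun t => π₂ (X t)) 0 x := by
      refine (hasDerivAt_const x (0 : ℂ)).congr_of_eventuallyEq ?_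
      filter_upwards [isOpen_Ioo.mem_nhds (⟨hx0, hx.2⟩ : x ∈ Ioo 0 P.β)] with t ht
      exact hS t (Ioo_subset_Icc_self ht)
    have he := hd.unique h0
    have hux : (X x).1 = 0 := hu x ⟨hx0.le, hx.2.le⟩
    rw [mat_apply, π₂_apply, hux, P.c_of_mem ⟨hx.1, hx.2.trans hβγ⟩, mul_zero, zero_add] at he
    have hc : (P.c₀ : ℂ) ≠ 0 := by exact_mod_cast P.hc₀.ne'
    have hr' : (r : ℂ) ≠ 0 := by exact_mod_cast hr
    simpa [hc, hr'] using he
  -- a point of the coupling region inside the damped part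
  set x₀ := (P.α + P.β) / 2 with hx₀
  have hm : x₀ ∈ Ioo P.α P.β := ⟨by rw [hx₀]; linarith, by rw [hx₀]; linarith⟩
  have hm0 : 0 < x₀ := hα.trans hm.1
  have hq : π₄ (X x₀) = 0 := by
    have hd := solution_hasDerivAt hX π₃ (x := x₀) ⟨⟨hm0, hm.2.trans hβL⟩, by
      simp only [mem_insert_iff, mem_singleton_iff, not_or]
      exact ⟨hm.1.ne', hm.2.ne, (hm.2.trans hβγ).ne⟩⟩
    have h0 : HasDerivAt (fun t => π₃ (X t)) 0 x₀ := by
      refine (hasDerivAt_const x₀ (0 : ℂ)).congr_of_eventuallyEq ?_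
      filter_upwards [isOpen_Ioo.mem_nhds hm] with t ht
      exact hy t ht
    have he := hd.unique h0
    rwa [mat_apply] at he
  -- conservation of `|y_x|² + r² |y|²` on `(0, β)`
  have hcons : ∫ _ in 0..x₀, (0 : ℂ) =
      (π₄ (X x₀) * conj (π₄ (X x₀)) + (r : ℂ) ^ 2 * (π₃ (X x₀) * conj (π₃ (X x₀)))) -
        (π₄ (X 0) * conj (π₄ (X 0)) + (r : ℂ) ^ 2 * (π₃ (X 0) * conj (π₃ (X 0)))) := by
    have hc : ∀ T : Phase →L[ℂ] ℂ, Continuous fun t => T (X t) := fun T =>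
      T.continuous.comp X.continuous
    refine integral_eq_of_hasDerivAt_off_countable_of_le
      (fun t => π₄ (X t) * conj (π₄ (X t)) + (r : ℂ) ^ 2 * (π₃ (X t) * conj (π₃ (X t)))) _ hm0.le
      (toFinite {P.α, P.β, P.γ}).countable ?_ ?_ (by simp)
    · exact (((hc π₄).mul (Complex.continuous_conj.comp (hc π₄))).add (continuous_const.mul
        ((hc π₃).mul (Complex.continuous_conj.comp (hc π₃))))).continuousOn
    · rintro x ⟨hx, hx'⟩
      have hxm : x ∈ Ioo 0 P.L \ {P.α, P.β, P.γ} := ⟨⟨hx.1, by linarith [hx.2, hm.2]⟩, hx'⟩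
      have h4 := solution_hasDerivAt hX π₄ hxm
      have h3 := solution_hasDerivAt hX π₃ hxm
      refine ((hasDerivAt_mul_conj h4 h4).add
        ((hasDerivAt_mul_conj h3 h3).const_mul ((r : ℂ) ^ 2))).congr_deriv ?_
      have hux : (X x).1 = 0 := hu x ⟨hx.1.le, by linarith [hx.2, hm.2]⟩
      rw [mat_apply, π₃_apply, π₄_apply, π₃_apply, π₄_apply, hux]
      simp only [mul_zero, sub_zero, map_mul, map_neg, map_pow, Complex.conj_ofReal]
      ring
  rw [hq, hy x₀ hm, hy0] at hcons
  simp only [intervalIntegral.integral_zero, map_zero, mul_zero, add_zero, zero_sub] at hcons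
  have hq0 : π₄ (X 0) = 0 := by
    rw [eq_comm, neg_eq_zero, Complex.mul_conj] at hcons
    exact Complex.normSq_eq_zero.1 (by exact_mod_cast hcons)
  exact Prod.ext hu0 (Prod.ext (hS 0 (left_mem_Icc.2 P.hβ.le)) (Prod.ext hy0 hq0))

/-- At frequency zero both equations are `f'' = 0`. -/
theorem initial_eq_zero_of_freq_zero
    (hX : X = BoundedContinuousFunction.const ℝ X₀ + volterra (sysL P 0) X)
    (hu0 : π₁ (X 0) = 0) (hy0 : π₃ (X 0) = 0) (huL : π₁ (X P.L) = 0) (hyL : π₃ (X P.L) = 0) :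
    X 0 = 0 := by
  have hX0 : X 0 = X₀ := by
    rw [solution_eq hX (left_mem_Icc.2 P.hL.le), intervalIntegral.integral_same, add_zero]
  have hL : (P.L : ℂ) ≠ 0 := by exact_mod_cast P.hL.ne'
  have ha : (P.a : ℂ) ≠ 0 := by exact_mod_cast P.ha.ne'
  have hS : ∀ x ∈ Icc 0 P.L, (X x).2.1 = (X 0).2.1 := by
    intro x hx
    have := solution_comp_eq hX π₂ hx
    simpa [mat_apply, ← hX0] using this
  have hq : ∀ x ∈ Icc 0 P.L, (X x).2.2.2 = (X 0).2.2.2 := by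
    intro x hx
    have := solution_comp_eq hX π₄ hx
    simpa [mat_apply, ← hX0] using this
  have hS0 : (X 0).2.1 = 0 := by
    have h := solution_comp_eq hX π₁ (right_mem_Icc.2 P.hL.le)
    rw [huL, ← hX0, hu0, zero_add] at h
    have h' : ∫ t in 0..P.L, π₁ (mat P 0 t (X t)) = ∫ _ in 0..P.L, (P.a : ℂ)⁻¹ * (X 0).2.1 := by
      refine intervalIntegral.integral_congr fun t ht => ?_
      rw [uIcc_of_le P.hL.le] at ht
      rw [mat_apply, π₁_apply, hS t ht, stiff_zero, sub_self, mul_zero, add_zero]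
    rw [h', intervalIntegral.integral_const, sub_zero] at h
    simpa [P.hL.ne', ha] using h
  have hq0 : (X 0).2.2.2 = 0 := by
    have h := solution_comp_eq hX π₃ (right_mem_Icc.2 P.hL.le)
    rw [hyL, ← hX0, hy0, zero_add] at h
    have h' : ∫ t in 0..P.L, π₃ (mat P 0 t (X t)) = ∫ _ in 0..P.L, (X 0).2.2.2 := by
      refine intervalIntegral.integral_congr fun t ht => ?_
      rw [uIcc_of_le P.hL.le] at ht
      rw [mat_apply, π₃_apply, hq t ht]
    rw [h', intervalIntegral.integral_const, sub_zero] at h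
    simpa [P.hL.ne'] using h
  exact Prod.ext hu0 (Prod.ext hS0 (Prod.ext hy0 hq0))

/-- The homogeneous boundary value problem has only the zero solution. -/
theorem solution_eq_zero (hH : P.HypH)
    (hX : X = BoundedContinuousFunction.const ℝ X₀ + volterra (sysL P r) X)
    (hu0 : π₁ (X 0) = 0) (hy0 : π₃ (X 0) = 0) (huL : π₁ (X P.L) = 0) (hyL : π₃ (X P.L) = 0) :
    X = 0 ∧ X₀ = 0 := by
  have h0 : X 0 = 0 := by
    rcases eq_or_ne r 0 with rfl | hr
    · exact initial_eq_zero_of_freq_zero hX hu0 hy0 huL hyL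
    · exact initial_eq_zero_of_stress_eq_zero hr hX hu0 hy0
        (stress_eq_zero hH hr hX hu0 hy0 huL hyL)
  have hX0 : X₀ = 0 := by
    rw [← h0, solution_eq hX (left_mem_Icc.2 P.hL.le), intervalIntegral.integral_same, add_zero]
  refine ⟨?_, hX0⟩
  have hinj : Function.Injective ⇑(1 - volterra (sysL P r)) :=
    ((ContinuousLinearMap.isUnit_iff_bijective).1 (isUnit_one_sub_volterra_sysL P r)).1
  refine hinj ?_
  rw [map_zero]
  change X - volterra (sysL P r) X = 0
  rw [sub_eq_zero]
  nth_rewrite 1 [hX]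
  rw [hX0]
  ext1 x
  exact zero_add _

end Uniqueness

/-! ### Solution of the boundary value problem -/

section Existence

variable {P : Params}

/-- The bounded operator sending initial values to constant functions. -/
def constL : Phase →L[ℂ] (ℝ →ᵇ Phase) :=
  LinearMap.toContinuousLinearMap
    { toFun := fun X₀ => BoundedContinuousFunction.const ℝ X₀
      map_add' := fun _ _ => rfl
      map_smul' := fun _ _ => rfl }

/-- The initial values `(u, S, y, y_x)(0) = (0, s, 0, q)`. -/
def shoot : ℂ × ℂ →L[ℂ] Phase :=
  (0 : ℂ × ℂ →L[ℂ] ℂ).prod ((ContinuousLinearMap.fst ℂ ℂ ℂ).prod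
    ((0 : ℂ × ℂ →L[ℂ] ℂ).prod (ContinuousLinearMap.snd ℂ ℂ ℂ)))

/-- The boundary values `(u, y)` at `L`. -/
def endVal (P : Params) : (ℝ →ᵇ Phase) →L[ℂ] ℂ × ℂ :=
  (π₁.prod π₃).comp (BoundedContinuousFunction.evalCLM ℂ P.L)

/-- The inhomogeneous boundary value problem is solved by a bounded operator: the linear map from
`(S, y_x)(0)` to `(u, y)(L)` is injective by uniqueness, hence invertible. -/
theorem exists_solution_operator (hH : P.HypH) (r : ℝ) :
    ∃ Ψ : L2 0 P.L Phase →L[ℂ] (ℝ →ᵇ Phase), ∀ f, ∃ X₀ : Phase,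
      Ψ f = BoundedContinuousFunction.const ℝ X₀
        + prim 0 P.L (sysL P r (toL2 0 P.L (Ψ f)) + f) ∧
      π₁ X₀ = 0 ∧ π₃ X₀ = 0 ∧ π₁ (Ψ f P.L) = 0 ∧ π₃ (Ψ f P.L) = 0 := by
  obtain ⟨V, hV⟩ := isUnit_one_sub_volterra_sysL P r
  set Φ : (ℝ →ᵇ Phase) →L[ℂ] (ℝ →ᵇ Phase) := V⁻¹.val with hΦ
  have hsol : ∀ g, Φ g = g + volterra (sysL P r) (Φ g) := by
    intro g
    have h : ((1 - volterra (sysL P r)) * Φ) g = g := by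
      rw [← hV, hΦ, Units.mul_inv]; rfl
    have h' : Φ g - volterra (sysL P r) (Φ g) = g := h
    exact sub_eq_iff_eq_add.1 h'
  set T : ℂ × ℂ →L[ℂ] ℂ × ℂ := (endVal P).comp (Φ.comp (constL.comp shoot)) with hT
  have hTinj : Function.Injective (T : ℂ × ℂ →ₗ[ℂ] ℂ × ℂ) := by
    rw [injective_iff_map_eq_zero]
    intro s hs
    have hX := hsol (constL (shoot s))
    have hs' : endVal P (Φ (constL (shoot s))) = 0 := hs
    have hX0 : Φ (constL (shoot s)) 0 = shoot s := by
      rw [solution_eq hX (left_mem_Icc.2 P.hL.le), intervalIntegral.integral_same, add_zero]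
    have h := (solution_eq_zero hH hX (by rw [hX0]; rfl) (by rw [hX0]; rfl)
      (congrArg Prod.fst hs') (congrArg Prod.snd hs')).2
    exact Prod.ext (congrArg π₂ h) (congrArg π₄ h)
  set e := LinearEquiv.ofInjectiveEndo (T : ℂ × ℂ →ₗ[ℂ] ℂ × ℂ) hTinj with he
  set Ti : ℂ × ℂ →L[ℂ] ℂ × ℂ := LinearMap.toContinuousLinearMap (e.symm : ℂ × ℂ →ₗ[ℂ] ℂ × ℂ)
    with hTi
  have hTTi : ∀ s, T (Ti s) = s := fun s => e.apply_symm_apply s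
  -- the initial values that correct the boundary values at `L`
  set I₀ : L2 0 P.L Phase →L[ℂ] Phase :=
    -(shoot.comp (Ti.comp ((endVal P).comp (Φ.comp (prim 0 P.L))))) with hI₀
  refine ⟨Φ.comp (constL.comp I₀ + prim 0 P.L), fun f => ⟨I₀ f, ?_, ?_, ?_, ?_⟩⟩
  · rw [map_add]
    refine (hsol _).trans ?_
    change constL (I₀ f) + prim 0 P.L f + prim 0 P.L (sysL P r (toL2 0 P.L _)) =
      constL (I₀ f) + (prim 0 P.L (sysL P r (toL2 0 P.L _)) + prim 0 P.L f)
    abel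
  · simp [hI₀, shoot]
  · simp [hI₀, shoot]
  · have hend : endVal P (Φ (constL (I₀ f) + prim 0 P.L f)) = 0 := by
      rw [map_add, map_add, hI₀]
      change endVal P (Φ (constL (-(shoot (Ti (endVal P (Φ (prim 0 P.L f)))))))) + _ = 0
      rw [map_neg, map_neg, map_neg, neg_add_eq_zero]
      exact hTTi _
    exact ⟨congrArg Prod.fst hend, congrArg Prod.snd hend⟩

end Existence

/-! ### The transport equation of the delay -/

section Delay

variable {E : Type} [NormedAddCommGroup E] [NormedSpace ℂ E]

theorem norm_exp_I_mul (θ ρ : ℝ) : ‖Complex.exp (Complex.I * θ * ρ)‖ = 1 := by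
  have : Complex.I * θ * ρ = ((θ * ρ : ℝ) : ℂ) * Complex.I := by push_cast; ring
  rw [this, Complex.norm_exp_ofReal_mul_I]

theorem memLp_exp (θ : ℝ) :
    MemLp (fun ρ : ℝ => Complex.exp (Complex.I * θ * ρ)) ∞ (leb 0 1) :=
  memLp_top_of_bound (by fun_prop) 1
    (Filter.Eventually.of_forall fun ρ => (norm_exp_I_mul θ ρ).le)

theorem exp_neg_mul_exp (θ ρ : ℝ) :
    Complex.exp (Complex.I * (-θ : ℝ) * ρ) * Complex.exp (Complex.I * θ * ρ) = 1 := by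
  rw [← Complex.exp_add, Complex.ofReal_neg]
  simp

/-- The solution of `η_ρ + iθ η = 0`, `η(0) = e`, as a function of `e`. -/
def delayInit (θ : ℝ) : E →L[ℂ] L2 0 1 E :=
  (mulL (memLp_exp (-θ))).comp (Lp.constL 2 (leb 0 1) ℂ)

/-- The solution of `η_ρ + iθ η = f`, `η(0) = 0`, as a function of `f`. -/
def delayForce (θ : ℝ) : L2 0 1 E →L[ℂ] L2 0 1 E :=
  (mulL (memLp_exp (-θ))).comp ((toL2 0 1).comp ((prim 0 1).comp (mulL (memLp_exp θ))))

/-- The continuous representative of the solution of `η_ρ + iθ η = f`, `η(0) = e`. -/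
def delayRep (θ : ℝ) (e : E) (f : L2 0 1 E) (ρ : ℝ) : E :=
  Complex.exp (Complex.I * (-θ : ℝ) * ρ) • (e + prim 0 1 (mulL (memLp_exp θ) f) ρ)

/-- The value at `ρ = 1` of the solution of `η_ρ + iθ η = f`, `η(0) = 0`. -/
def delayEnd (θ : ℝ) : L2 0 1 E →L[ℂ] E :=
  Complex.exp (-(Complex.I * θ)) •
    (BoundedContinuousFunction.evalCLM ℂ 1).comp ((prim 0 1).comp (mulL (memLp_exp θ)))

theorem continuous_delayRep (θ : ℝ) (e : E) (f : L2 0 1 E) : Continuous (delayRep θ e f) := by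
  have h := (prim 0 1 (mulL (memLp_exp θ) f)).continuous
  unfold delayRep
  fun_prop

theorem delayRep_zero (θ : ℝ) (e : E) (f : L2 0 1 E) : delayRep θ e f 0 = e := by
  simp [delayRep]

theorem delayRep_one (θ : ℝ) (e : E) (f : L2 0 1 E) :
    delayRep θ e f 1 = Complex.exp (-(Complex.I * θ)) • e + delayEnd θ f := by
  simp [delayRep, delayEnd]

theorem coeFn_delay (θ : ℝ) (e : E) (f : L2 0 1 E) :
    ⇑(delayInit θ e + delayForce θ f) =ᵐ[leb 0 1] delayRep θ e f := by
  filter_upwards [Lp.coeFn_add (delayInit θ e) (delayForce θ f),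
    coeFn_mulL (memLp_exp (-θ)) (Lp.constL 2 (leb 0 1) ℂ e),
    coeFn_mulL (memLp_exp (-θ)) (toL2 0 1 (prim 0 1 (mulL (memLp_exp θ) f))),
    coeFn_toL2 (p := 0) (q := 1) (prim 0 1 (mulL (memLp_exp θ) f)),
    Lp.coeFn_const (p := 2) (μ := leb 0 1) e] with ρ h1 h2 h3 h4 h5
  have h2' : (delayInit θ e) ρ = Complex.exp (Complex.I * (-θ : ℝ) * ρ) • e := by
    refine h2.trans ?_
    change _ • (Lp.const 2 (leb 0 1) e) ρ = _
    rw [h5]; rfl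
  have h3' : (delayForce θ f) ρ = _ := h3
  rw [h1, Pi.add_apply, h2', h3', h4, delayRep, smul_add]

theorem isWeakDeriv_delay [CompleteSpace E] (θ : ℝ) (e : E) (f : L2 0 1 E) :
    IsWeakDeriv 0 1 ⇑(delayInit θ e + delayForce θ f)
      ⇑(f - (Complex.I * θ) • (delayInit θ e + delayForce θ f)) := by
  have h := isWeakDeriv_const_add_prim one_pos e (mulL (memLp_exp θ) f)
  have h' := h.exp_smul ((integrable_const e).add (integrable_bcf _))
    (mulL (memLp_exp θ) f).integrable (-θ)
  refine h'.congr (coeFn_delay θ e f) ?_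
  filter_upwards [coeFn_delay θ e f, coeFn_mulL (memLp_exp θ) f,
    Lp.coeFn_sub f ((Complex.I * θ) • (delayInit θ e + delayForce θ f)),
    Lp.coeFn_smul (Complex.I * θ) (delayInit θ e + delayForce θ f)] with ρ h1 h2 h3 h4
  rw [h3, Pi.sub_apply, h4, Pi.smul_apply, h1, h2, delayRep,
    smul_add _ (Complex.exp (Complex.I * θ * ρ) • f ρ), smul_smul _ _ (f ρ), exp_neg_mul_exp,
    one_smul, Complex.ofReal_neg]
  module

/-- A solution of `η_ρ + iθ η = 0` is `e^{-iθρ} η(0)`. -/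
theorem eq_exp_smul_of_isWeakDeriv [CompleteSpace E] {θ : ℝ} {η ηρ : L2 0 1 E} {w : ℝ → E}
    (h : IsWeakDeriv 0 1 η ηρ) (hη : ηρ = -((Complex.I * θ) • η)) (hw : IsContRep 0 1 η w) :
    ∀ ρ ∈ Icc (0 : ℝ) 1, w ρ = Complex.exp (Complex.I * (-θ : ℝ) * ρ) • w 0 := by
  have h' := h.exp_smul η.integrable ηρ.integrable θ
  have h0 : IsWeakDeriv 0 1 (fun ρ : ℝ => Complex.exp (Complex.I * θ * ρ) • w ρ)
      (fun _ => (0 : E)) := by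
    refine h'.congr ?_ ?_
    · filter_upwards [hw.ae_eq] with ρ h1
      rw [h1]
    · filter_upwards [Lp.coeFn_neg ((Complex.I * (θ : ℂ)) • η),
        Lp.coeFn_smul (Complex.I * (θ : ℂ)) η] with ρ h1 h2
      rw [hη, h1, Pi.neg_apply, h2, Pi.smul_apply, neg_add_cancel, smul_zero]
  have hcont : ContinuousOn (fun ρ : ℝ => Complex.exp (Complex.I * θ * ρ) • w ρ) (Icc 0 1) := by
    refine ContinuousOn.smul (Continuous.continuousOn (by fun_prop)) hw.cont
  obtain ⟨e, he⟩ := h0.ae_const (hcont.integrableOn_Icc.mono_set Ioo_subset_Icc_self)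
  have hEq := eqOn_Icc_of_ae_eq one_pos hcont continuousOn_const he
  have h00 : w 0 = e := by simpa using hEq (left_mem_Icc.2 zero_le_one)
  intro ρ hρ
  have hρ' : Complex.exp (Complex.I * θ * ρ) • w ρ = e := hEq hρ
  rw [h00, ← hρ', smul_smul, exp_neg_mul_exp, one_smul]

end Delay

/-! ### Square-integrable functions with values in the phase space -/

/-- The element of `L²` with values in the phase space that has the given four components. -/
def phaseL (p q : ℝ) : (L2 p q ℂ × L2 p q ℂ × L2 p q ℂ × L2 p q ℂ) →L[ℂ] L2 p q Phase :=
  ((ContinuousLinearMap.inl ℂ ℂ (ℂ × ℂ × ℂ)).compLpL 2 (leb p q)).coprod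
    ((((ContinuousLinearMap.inr ℂ ℂ (ℂ × ℂ × ℂ)).comp
        (ContinuousLinearMap.inl ℂ ℂ (ℂ × ℂ))).compLpL 2 (leb p q)).coprod
      ((((ContinuousLinearMap.inr ℂ ℂ (ℂ × ℂ × ℂ)).comp
        ((ContinuousLinearMap.inr ℂ ℂ (ℂ × ℂ)).comp
          (ContinuousLinearMap.inl ℂ ℂ ℂ))).compLpL 2 (leb p q)).coprod
        (((ContinuousLinearMap.inr ℂ ℂ (ℂ × ℂ × ℂ)).comp
          ((ContinuousLinearMap.inr ℂ ℂ (ℂ × ℂ)).comp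
            (ContinuousLinearMap.inr ℂ ℂ ℂ))).compLpL 2 (leb p q))))

theorem coeFn_phaseL {p q : ℝ} (f g h k : L2 p q ℂ) :
    phaseL p q (f, g, h, k) =ᵐ[leb p q] fun x => (f x, g x, h x, k x) := by
  set i₁ := ContinuousLinearMap.inl ℂ ℂ (ℂ × ℂ × ℂ)
  set i₂ := (ContinuousLinearMap.inr ℂ ℂ (ℂ × ℂ × ℂ)).comp
        (ContinuousLinearMap.inl ℂ ℂ (ℂ × ℂ))
  set i₃ := (ContinuousLinearMap.inr ℂ ℂ (ℂ × ℂ × ℂ)).comp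
        ((ContinuousLinearMap.inr ℂ ℂ (ℂ × ℂ)).comp (ContinuousLinearMap.inl ℂ ℂ ℂ))
  set i₄ := (ContinuousLinearMap.inr ℂ ℂ (ℂ × ℂ × ℂ)).comp
        ((ContinuousLinearMap.inr ℂ ℂ (ℂ × ℂ)).comp (ContinuousLinearMap.inr ℂ ℂ ℂ))
  have e : phaseL p q (f, g, h, k) = i₁.compLpL 2 (leb p q) f + (i₂.compLpL 2 (leb p q) g +
      (i₃.compLpL 2 (leb p q) h + i₄.compLpL 2 (leb p q) k)) := rfl
  rw [e]
  filter_upwards [i₁.coeFn_compLpL f, i₂.coeFn_compLpL g, i₃.coeFn_compLpL h, i₄.coeFn_compLpL k,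
    Lp.coeFn_add (i₁.compLpL 2 (leb p q) f) (i₂.compLpL 2 (leb p q) g +
      (i₃.compLpL 2 (leb p q) h + i₄.compLpL 2 (leb p q) k)),
    Lp.coeFn_add (i₂.compLpL 2 (leb p q) g)
      (i₃.compLpL 2 (leb p q) h + i₄.compLpL 2 (leb p q) k),
    Lp.coeFn_add (i₃.compLpL 2 (leb p q) h) (i₄.compLpL 2 (leb p q) k)] with
    x h1 h2 h3 h4 h5 h6 h7
  rw [h5, Pi.add_apply, h6, Pi.add_apply, h7, Pi.add_apply, h1, h2, h3, h4]
  simp [i₁, i₂, i₃, i₄]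

theorem compLpL_phaseL {p q : ℝ} (f g h k : L2 p q ℂ) :
    π₁.compLpL 2 (leb p q) (phaseL p q (f, g, h, k)) = f ∧
    π₂.compLpL 2 (leb p q) (phaseL p q (f, g, h, k)) = g ∧
    π₃.compLpL 2 (leb p q) (phaseL p q (f, g, h, k)) = h ∧
    π₄.compLpL 2 (leb p q) (phaseL p q (f, g, h, k)) = k := by
  refine ⟨Lp.ext ?_, Lp.ext ?_, Lp.ext ?_, Lp.ext ?_⟩
  · filter_upwards [π₁.coeFn_compLpL (phaseL p q (f, g, h, k)), coeFn_phaseL f g h k] with x h1 h2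
    rw [h1, h2, π₁_apply]
  · filter_upwards [π₂.coeFn_compLpL (phaseL p q (f, g, h, k)), coeFn_phaseL f g h k] with x h1 h2
    rw [h1, h2, π₂_apply]
  · filter_upwards [π₃.coeFn_compLpL (phaseL p q (f, g, h, k)), coeFn_phaseL f g h k] with x h1 h2
    rw [h1, h2, π₃_apply]
  · filter_upwards [π₄.coeFn_compLpL (phaseL p q (f, g, h, k)), coeFn_phaseL f g h k] with x h1 h2
    rw [h1, h2, π₄_apply]

/-! ### The resolvent on the imaginary axis -/

theorem b_symb (P : Params) (r : ℝ) (x : ℝ) :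
    (P.a : ℂ) + P.b x * (Complex.I * r * symb P r) = P.a + P.b x * (stiff P r - P.a) := by
  rw [stiff]; ring

/-- The coefficient of `S` in the equation for `u_x` is the reciprocal of `a + i r b k`. -/
theorem coef_mul (P : Params) (hH : P.HypH) (r : ℝ) (x : ℝ) :
    (P.a + P.b x * (Complex.I * r * symb P r)) *
      ((P.a : ℂ)⁻¹ + P.b x * ((stiff P r)⁻¹ - (P.a : ℂ)⁻¹)) = 1 := by
  have ha : (P.a : ℂ) ≠ 0 := by exact_mod_cast P.ha.ne'
  rw [b_symb]
  by_cases hx : x ∈ Ioo 0 P.β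
  · rw [P.b_of_mem hx, one_mul, one_mul, add_sub_cancel, add_sub_cancel,
      mul_inv_cancel₀ (stiff_ne_zero hH r)]
  · rw [P.b_of_notMem hx, zero_mul, zero_mul, add_zero, add_zero, mul_inv_cancel₀ ha]

theorem symb_eq_delay_factor (P : Params) (r : ℝ) :
    (P.κ₁ : ℂ) + P.κ₂ * Complex.exp (-(Complex.I * (r * P.τ : ℝ))) = symb P r := by
  rw [symb]; push_cast; ring_nf

section Kernel

variable {P : Params} {r : ℝ}

/-- There are no eigenvalues on the imaginary axis. -/
theorem eq_zero_of_mem_graphA (hH : P.HypH) {U : State P}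
    (h : (U, (Complex.I * r) • U) ∈ graphA P) : U = 0 := by
  obtain ⟨v, z, Sx, yxx, ηρ, w, h⟩ := h
  have hv : v = (Complex.I * r) • U.u := h.u_eq.symm
  have hz : z = (Complex.I * r) • U.y := h.y_eq.symm
  have hτ : (P.τ : ℂ) ≠ 0 := by exact_mod_cast P.hτ.ne'
  have hηρ : ηρ = -((Complex.I * (r * P.τ : ℝ)) • U.η) := by
    have h1 : (Complex.I * r) • U.η = (-(P.τ : ℂ)⁻¹) • ηρ := h.η_eq
    have h2 := congrArg (fun x => (-(P.τ : ℂ)) • x) h1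
    simp only [smul_smul, neg_mul_neg, mul_inv_cancel₀ hτ, one_smul] at h2
    rw [← h2, ← neg_smul]
    congr 1
    push_cast; ring
  have hw := eq_exp_smul_of_isWeakDeriv h.η_deriv hηρ h.η_rep
  have hw0 : w 0 = restrictH1 P v := eq_restrictH1 P (by rw [h.v_mem]; exact h.η_zero)
  have hw1 : w 1 = Complex.exp (-(Complex.I * (r * P.τ : ℝ))) • restrictH1 P v := by
    rw [hw 1 (right_mem_Icc.2 zero_le_one), hw0]
    push_cast
    rw [mul_one, mul_neg]
  -- the stress is a multiple of `u_x`
  have hstress : stress P U.u v (w 1) =ᵐ[leb 0 P.L]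
      fun x => (P.a + P.b x * (Complex.I * r * symb P r)) * U.u.dx x := by
    have hvd : v.dx = (Complex.I * r) • U.u.dx := by rw [hv, map_smul]
    have hwd : (w 1).dx = Complex.exp (-(Complex.I * (r * P.τ : ℝ))) • (restrictH1 P v).dx := by
      rw [hw1, map_smul]
    filter_upwards [Lp.coeFn_smul (Complex.I * (r : ℂ)) U.u.dx,
      ae_b (Lp.coeFn_smul (Complex.exp (-(Complex.I * (r * P.τ : ℝ)))) (restrictH1 P v).dx),
      ae_b (dx_restrictH1 P v)] with x h1 h2 h3
    rw [stress]
    rcases h2 with h2 | h2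
    · rw [h2]; ring
    rcases h3 with h3 | h3
    · rw [h3]; ring
    rw [hwd, h2, Pi.smul_apply, h3, hvd, h1, Pi.smul_apply, smul_eq_mul, smul_eq_mul,
      ← symb_eq_delay_factor]
    ring
  obtain ⟨s₀, hs₀⟩ := h.stress_deriv.exists_ae_eq_prim P.hL (stress_integrable _ _ _)
  obtain ⟨q₀, hq₀⟩ := h.y_deriv.exists_ae_eq_prim P.hL U.y.dx.integrable
  -- the associated solution of the first-order system
  set D : L2 0 P.L Phase := phaseL 0 P.L (U.u.dx, Sx, U.y.dx, yxx) with hD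
  set X₀ : Phase := (0, s₀, 0, q₀) with hX₀
  set X : ℝ →ᵇ Phase := BoundedContinuousFunction.const ℝ X₀ + prim 0 P.L D with hXdef
  obtain ⟨d1, d2, d3, d4⟩ := compLpL_phaseL U.u.dx Sx U.y.dx yxx
  have hXx : ∀ (T : Phase →L[ℂ] ℂ) (x : ℝ),
      T (X x) = T X₀ + prim 0 P.L (T.compLpL 2 (leb 0 P.L) D) x := by
    intro T x
    rw [← map_prim, ← map_add]; rfl
  have hX1 : ∀ x, (X x).1 = prim 0 P.L U.u.dx x := fun x => by
    rw [← π₁_apply, hXx, hD, d1, π₁_apply, zero_add]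
  have hX2 : ∀ x, (X x).2.1 = s₀ + prim 0 P.L Sx x := fun x => by
    rw [← π₂_apply, hXx, hD, d2, π₂_apply]
  have hX3 : ∀ x, (X x).2.2.1 = prim 0 P.L U.y.dx x := fun x => by
    rw [← π₃_apply, hXx, hD, d3, π₃_apply, zero_add]
  have hX4 : ∀ x, (X x).2.2.2 = q₀ + prim 0 P.L yxx x := fun x => by
    rw [← π₄_apply, hXx, hD, d4, π₄_apply]
  have hUv : U.v = (Complex.I * r) • U.u.fn := by rw [← h.v_mem, hv, map_smul]
  have hUz : U.z = (Complex.I * r) • U.y.fn := by rw [← h.z_mem, hz, map_smul]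
  have hDsys : D = sysL P r (toL2 0 P.L X) := by
    refine Lp.ext ?_
    have hFv : ((Complex.I * r) • U).v = (Complex.I * r) • U.v := rfl
    have hFz : ((Complex.I * r) • U).z = (Complex.I * r) • U.z := rfl
    have e1 := h.v_eq
    have e2 := h.z_eq
    simp only at e1 e2
    rw [hFv] at e1
    rw [hFz] at e2
    filter_upwards [coeFn_sysL P r (toL2 0 P.L X), coeFn_toL2 (p := 0) (q := P.L) X,
      coeFn_phaseL U.u.dx Sx U.y.dx yxx, hs₀, hq₀, hstress, e1, e2,
      Lp.coeFn_smul (Complex.I * (r : ℂ)) U.v, Lp.coeFn_smul (Complex.I * (r : ℂ)) U.z,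
      Lp.coeFn_smul (Complex.I * (r : ℂ)) U.u.fn, Lp.coeFn_smul (Complex.I * (r : ℂ)) U.y.fn,
      H1Van.fn_ae_eq_prim P.hL U.u, H1Van.fn_ae_eq_prim P.hL U.y]
      with x h1 h2 h3 h4 h5 h6 h7 h8 h9 h10 h11 h12 h13 h14
    rw [← hUv, Pi.smul_apply, h13, ← hX1, smul_eq_mul] at h11
    rw [← hUz, Pi.smul_apply, h14, ← hX3, smul_eq_mul] at h12
    rw [h9, Pi.smul_apply, h11, h12, smul_eq_mul] at h7
    rw [h10, Pi.smul_apply, h11, h12, smul_eq_mul] at h8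
    rw [h1, h2, h3, mat_apply]
    refine Prod.ext ?_ (Prod.ext ?_ (Prod.ext ?_ ?_))
    · change U.u.dx x = _ * (X x).2.1
      rw [hX2, ← h4, h6, ← mul_assoc, mul_comm _ (_ + P.b x * _), coef_mul P hH, one_mul]
    · change Sx x = _
      linear_combination -h7 + (r : ℂ) ^ 2 * (X x).1 * Complex.I_sq
    · change U.y.dx x = (X x).2.2.2
      rw [hX4, h5]
    · change yxx x = _
      linear_combination -h8 + (r : ℂ) ^ 2 * (X x).2.2.1 * Complex.I_sq
  have hX : X = BoundedContinuousFunction.const ℝ X₀ + volterra (sysL P r) X := by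
    change X = BoundedContinuousFunction.const ℝ X₀ + prim 0 P.L (sysL P r (toL2 0 P.L X))
    rw [← hDsys]
  have hL : P.L ∈ Icc 0 P.L := right_mem_Icc.2 P.hL.le
  have hzero := (solution_eq_zero hH hX
    ((hX1 0).trans (prim_left _)) ((hX3 0).trans (prim_left _))
    ((hX1 _).trans (H1Van.prim_dx_eq_zero P.hL U.u (mem_singleton _) hL))
    ((hX3 _).trans (H1Van.prim_dx_eq_zero P.hL U.y (mem_singleton _) hL))).1
  have hD0 : D = 0 := by rw [hDsys, hzero, map_zero, map_zero]
  have hu : U.u = 0 := H1Van.dx_injective (by rw [← d1, ← hD, hD0, map_zero, map_zero])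
  have hy : U.y = 0 := H1Van.dx_injective (by rw [← d3, ← hD, hD0, map_zero, map_zero])
  have hη : U.η = 0 := by
    refine (Lp.eq_zero_iff_ae_eq_zero).2 ?_
    filter_upwards [h.η_rep.ae_eq, ae_restrict_mem measurableSet_Ioo] with ρ h1 h2
    rw [h1, hw ρ (Ioo_subset_Icc_self h2), hw0, hv, hu, smul_zero, map_zero, smul_zero]
    rfl
  exact State.ext hu (by rw [hUv, hu, map_zero, smul_zero]; rfl) hy
    (by rw [hUz, hy, map_zero, smul_zero]; rfl) hη

end Kernel

section Resolvent

variable (P : Params) (r : ℝ)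

/-- The contribution of the datum `η` to the value `η(·, 1)` of the solution. -/
def endForce : State P →L[ℂ] H1Left 0 P.β :=
  (P.τ : ℂ) • (delayEnd (r * P.τ)).comp (State.ηL P)

/-- The inhomogeneity in the equation for `u_x`. -/
def forceU : State P →L[ℂ] L2 0 P.L ℂ :=
  (stiff P r)⁻¹ • (symb P r • (mulL P.memLp_b).comp (H1Van.dxL.comp (State.uL P))
    - (P.κ₂ : ℂ) • (extendL P.hβL.le).comp (H1Van.dxL.comp (endForce P r)))

/-- The inhomogeneity in the equation for `S_x`. -/
def forceS : State P →L[ℂ] L2 0 P.L ℂ :=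
  -((Complex.I * r) • H1Van.fnL.comp (State.uL P)
    + ((mulL P.memLp_c).comp (H1Van.fnL.comp (State.yL P)) + State.vL P))

/-- The inhomogeneity in the equation for `y_xx`. -/
def forceY : State P →L[ℂ] L2 0 P.L ℂ :=
  (mulL P.memLp_c).comp (H1Van.fnL.comp (State.uL P))
    - ((Complex.I * r) • H1Van.fnL.comp (State.yL P) + State.zL P)

/-- The inhomogeneity of the first-order system. -/
def force : State P →L[ℂ] L2 0 P.L Phase :=
  (phaseL 0 P.L).comp ((forceU P r).prod ((forceS P r).prod
    ((0 : State P →L[ℂ] L2 0 P.L ℂ).prod (forceY P r))))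

variable {P r}

theorem coeFn_forceU (F : State P) : forceU P r F =ᵐ[leb 0 P.L] fun x =>
    (stiff P r)⁻¹ * (symb P r * (P.b x * F.u.dx x)
      - P.κ₂ * (Ioo 0 P.β).indicator (endForce P r F).dx x) := by
  set f := mulL P.memLp_b F.u.dx with hf
  set g := extendL P.hβL.le (endForce P r F).dx with hg
  have e : forceU P r F = (stiff P r)⁻¹ • (symb P r • f - (P.κ₂ : ℂ) • g) := rfl
  rw [e]
  filter_upwards [Lp.coeFn_smul (stiff P r)⁻¹ (symb P r • f - (P.κ₂ : ℂ) • g),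
    Lp.coeFn_sub (symb P r • f) ((P.κ₂ : ℂ) • g), Lp.coeFn_smul (symb P r) f,
    Lp.coeFn_smul (P.κ₂ : ℂ) g, coeFn_mulL P.memLp_b F.u.dx,
    coeFn_extendL P.hβL.le (endForce P r F).dx] with x h1 h2 h3 h4 h5 h6
  rw [h1, Pi.smul_apply, h2, Pi.sub_apply, h3, h4, Pi.smul_apply, Pi.smul_apply, hf, hg, h5, h6]
  rfl

theorem coeFn_forceS (F : State P) : forceS P r F =ᵐ[leb 0 P.L] fun x =>
    -(Complex.I * r * F.u.fn x + (P.c x * F.y.fn x + F.v x)) := by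
  have e : forceS P r F = -((Complex.I * (r : ℂ)) • F.u.fn + (mulL P.memLp_c F.y.fn + F.v)) := by
    rw [← H1Van.fnL_apply P.hL, ← H1Van.fnL_apply P.hL]; rfl
  rw [e]
  filter_upwards [Lp.coeFn_neg ((Complex.I * (r : ℂ)) • F.u.fn + (mulL P.memLp_c F.y.fn + F.v)),
    Lp.coeFn_add ((Complex.I * (r : ℂ)) • F.u.fn) (mulL P.memLp_c F.y.fn + F.v),
    Lp.coeFn_add (mulL P.memLp_c F.y.fn) F.v, Lp.coeFn_smul (Complex.I * (r : ℂ)) F.u.fn,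
    coeFn_mulL P.memLp_c F.y.fn] with x h1 h2 h3 h4 h5
  rw [h1, Pi.neg_apply, h2, Pi.add_apply, h3, Pi.add_apply, h4, h5]
  rfl

theorem coeFn_forceY (F : State P) : forceY P r F =ᵐ[leb 0 P.L] fun x =>
    P.c x * F.u.fn x - (Complex.I * r * F.y.fn x + F.z x) := by
  have e : forceY P r F = mulL P.memLp_c F.u.fn - ((Complex.I * (r : ℂ)) • F.y.fn + F.z) := by
    rw [← H1Van.fnL_apply P.hL, ← H1Van.fnL_apply P.hL]; rfl
  rw [e]
  filter_upwards [Lp.coeFn_sub (mulL P.memLp_c F.u.fn) ((Complex.I * (r : ℂ)) • F.y.fn + F.z),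
    Lp.coeFn_add ((Complex.I * (r : ℂ)) • F.y.fn) F.z,
    Lp.coeFn_smul (Complex.I * (r : ℂ)) F.y.fn,
    coeFn_mulL P.memLp_c F.u.fn] with x h1 h2 h3 h4
  rw [h1, Pi.sub_apply, h2, Pi.add_apply, h3, h4]
  rfl

/-- The stress of a resolvent candidate is `m u_x` up to the inhomogeneity of the strain
equation. -/
theorem stress_ae_eq (hH : P.HypH) {F : State P} {u v : H1Zero 0 P.L} {e : H1Left 0 P.β}
    {S : ℝ → ℂ} (hv : v = (Complex.I * r) • u - F.u)
    (he : e = Complex.exp (-(Complex.I * (r * P.τ : ℝ))) • restrictH1 P v + endForce P r F)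
    (hu : u.dx =ᵐ[leb 0 P.L] fun x =>
      ((P.a : ℂ)⁻¹ + P.b x * ((stiff P r)⁻¹ - (P.a : ℂ)⁻¹)) * S x + forceU P r F x) :
    stress P u v e =ᵐ[leb 0 P.L] S := by
  have hvd : v.dx = (Complex.I * r) • u.dx - F.u.dx := by rw [hv, map_sub, map_smul]
  have hed : e.dx = Complex.exp (-(Complex.I * (r * P.τ : ℝ))) • (restrictH1 P v).dx
      + (endForce P r F).dx := by
    rw [he, map_add, map_smul]
  have hae : ∀ᵐ x ∂leb 0 P.β, e.dx x =
      Complex.exp (-(Complex.I * (r * P.τ : ℝ))) * v.dx x + (endForce P r F).dx x := by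
    filter_upwards [Lp.coeFn_add (Complex.exp (-(Complex.I * (r * P.τ : ℝ))) •
        (restrictH1 P v).dx) (endForce P r F).dx,
      Lp.coeFn_smul (Complex.exp (-(Complex.I * (r * P.τ : ℝ)))) (restrictH1 P v).dx,
      dx_restrictH1 P v] with x h1 h2 h3
    rw [hed, h1, Pi.add_apply, h2, Pi.smul_apply, h3, smul_eq_mul]
  have ha : (P.a : ℂ) ≠ 0 := by exact_mod_cast P.ha.ne'
  have hm := stiff_ne_zero hH r
  filter_upwards [Lp.coeFn_sub ((Complex.I * (r : ℂ)) • u.dx) F.u.dx,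
    Lp.coeFn_smul (Complex.I * (r : ℂ)) u.dx, ae_indicator (q := P.L) hae, hu, coeFn_forceU F]
    with x h1 h2 h3 h4 h5
  rw [stress, hvd, h1, Pi.sub_apply, h2, Pi.smul_apply, smul_eq_mul]
  by_cases hx : x ∈ Ioo 0 P.β
  · rw [h3 hx, hvd, h1, Pi.sub_apply, h2, Pi.smul_apply, smul_eq_mul, P.b_of_mem hx]
    rw [P.b_of_mem hx, indicator_of_mem hx] at h5
    rw [h5, P.b_of_mem hx] at h4
    -- `u_x = m⁻¹ (S + k f_x - κ₂ G_x)` on the damped part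
    have h6 : stiff P r * u.dx x =
        S x + (symb P r * F.u.dx x - P.κ₂ * (endForce P r F).dx x) := by
      rw [h4]; field_simp; ring
    rw [stiff, ← symb_eq_delay_factor] at h6
    linear_combination h6
  · rw [P.b_of_notMem hx, indicator_of_notMem hx] at h5
    rw [h5, P.b_of_notMem hx] at h4
    rw [P.b_of_notMem hx, h4]
    field_simp
    ring

/-- The resolvent equation is solved by a bounded operator. -/
theorem exists_resolvent (hH : P.HypH) (r : ℝ) : ∃ R : State P →L[ℂ] State P,
    ∀ F, (R F, (Complex.I * r) • R F - F) ∈ graphA P := by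
  obtain ⟨Ψ, hΨ⟩ := exists_solution_operator hH r
  set Xop : State P →L[ℂ] (ℝ →ᵇ Phase) := Ψ.comp (force P r) with hXop
  -- the derivative of the solution of the first-order system
  set D : State P →L[ℂ] L2 0 P.L Phase :=
    (sysL P r).comp ((toL2 0 P.L).comp Xop) + force P r with hD
  have hsol : ∀ F, ∃ X₀ : Phase,
      Xop F = BoundedContinuousFunction.const ℝ X₀ + prim 0 P.L (D F) ∧
      π₁ X₀ = 0 ∧ π₃ X₀ = 0 ∧ π₁ (Xop F P.L) = 0 ∧ π₃ (Xop F P.L) = 0 := fun F =>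
    hΨ (force P r F)
  have hcomp : ∀ (T : Phase →L[ℂ] ℂ) (F : State P) (X₀ : Phase),
      Xop F = BoundedContinuousFunction.const ℝ X₀ + prim 0 P.L (D F) → ∀ x,
      T (Xop F x) = T X₀ + prim 0 P.L (T.compLpL 2 (leb 0 P.L) (D F)) x := by
    intro T F X₀ h x
    rw [← map_prim, ← map_add, h]; rfl
  have hendU : ∀ F, ∀ x ∈ ({P.L} : Set ℝ),
      prim 0 P.L ((π₁.compLpL 2 (leb 0 P.L)).comp D F) x = 0 := by
    rintro F x rfl
    obtain ⟨X₀, h, h1, -, h2, -⟩ := hsol F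
    have := hcomp π₁ F X₀ h P.L
    rw [h1, h2, zero_add] at this
    exact this.symm
  have hendY : ∀ F, ∀ x ∈ ({P.L} : Set ℝ),
      prim 0 P.L ((π₃.compLpL 2 (leb 0 P.L)).comp D F) x = 0 := by
    rintro F x rfl
    obtain ⟨X₀, h, -, h1, -, h2⟩ := hsol F
    have := hcomp π₃ F X₀ h P.L
    rw [h1, h2, zero_add] at this
    exact this.symm
  set Ru : State P →L[ℂ] H1Zero 0 P.L := H1Van.lift P.hL _ hendU with hRu
  set Ry : State P →L[ℂ] H1Zero 0 P.L := H1Van.lift P.hL _ hendY with hRy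
  set Rv : State P →L[ℂ] H1Zero 0 P.L := (Complex.I * r) • Ru - State.uL P with hRv
  set Rz : State P →L[ℂ] H1Zero 0 P.L := (Complex.I * r) • Ry - State.yL P with hRz
  set Rη : State P →L[ℂ] P.W := (delayInit (r * P.τ)).comp ((restrictH1 P).comp Rv)
    + (delayForce (r * P.τ)).comp ((P.τ : ℂ) • State.ηL P) with hRη
  refine ⟨(State.prodEquiv P).symm.toContinuousLinearMap.comp
    (Ru.prod ((H1Van.fnL.comp Rv).prod (Ry.prod ((H1Van.fnL.comp Rz).prod Rη)))), fun F => ?_⟩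
  obtain ⟨X₀, hX, h1, h3, -, -⟩ := hsol F
  set X := Xop F with hXF
  set w := delayRep (r * P.τ) (restrictH1 P (Rv F)) ((P.τ : ℂ) • F.η) with hw
  set U : State P := (Ru F, H1Van.fnL (Rv F), Ry F, H1Van.fnL (Rz F), Rη F) with hU
  change (U, (Complex.I * r) • U - F) ∈ graphA P
  have hτ : (P.τ : ℂ) ≠ 0 := by exact_mod_cast P.hτ.ne'
  have hvF : Rv F = (Complex.I * r) • Ru F - F.u := rfl
  have hzF : Rz F = (Complex.I * r) • Ry F - F.y := rfl
  -- pointwise form of the first-order system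
  have hDx : ∀ᵐ x ∂leb 0 P.L, D F x = mat P r x (X x) +
      (forceU P r F x, forceS P r F x, 0, forceY P r F x) := by
    have e : D F = sysL P r (toL2 0 P.L X) + force P r F := rfl
    rw [e]
    filter_upwards [Lp.coeFn_add (sysL P r (toL2 0 P.L X)) (force P r F),
      coeFn_sysL P r (toL2 0 P.L X), coeFn_toL2 (p := 0) (q := P.L) X,
      coeFn_phaseL (forceU P r F) (forceS P r F) 0 (forceY P r F),
      Lp.coeFn_zero ℂ 2 (leb 0 P.L)] with x e1 e2 e3 e4 e5
    rw [e1, Pi.add_apply, e2, e3]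
    refine congrArg _ (e4.trans ?_)
    rw [e5]; rfl
  have hfnU : (Ru F).fn =ᵐ[leb 0 P.L] fun x => (X x).1 := by
    refine (H1Van.fn_ae_eq_prim P.hL (Ru F)).trans (Filter.Eventually.of_forall fun x => ?_)
    have := hcomp π₁ F X₀ hX x
    rw [h1, zero_add] at this
    exact this.symm
  have hfnY : (Ry F).fn =ᵐ[leb 0 P.L] fun x => (X x).2.2.1 := by
    refine (H1Van.fn_ae_eq_prim P.hL (Ry F)).trans (Filter.Eventually.of_forall fun x => ?_)
    have := hcomp π₃ F X₀ hX x
    rw [h3, zero_add] at this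
    exact this.symm
  have hUv : U.v =ᵐ[leb 0 P.L] fun x => Complex.I * r * (X x).1 - F.u.fn x := by
    have e : U.v = (Complex.I * (r : ℂ)) • (Ru F).fn - F.u.fn := by
      change H1Van.fnL (Rv F) = _
      rw [H1Van.fnL_apply P.hL, hvF, map_sub, map_smul]
    rw [e]
    filter_upwards [Lp.coeFn_sub ((Complex.I * (r : ℂ)) • (Ru F).fn) F.u.fn,
      Lp.coeFn_smul (Complex.I * (r : ℂ)) (Ru F).fn, hfnU] with x e1 e2 e3
    rw [e1, Pi.sub_apply, e2, Pi.smul_apply, e3, smul_eq_mul]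
  have hUz : U.z =ᵐ[leb 0 P.L] fun x => Complex.I * r * (X x).2.2.1 - F.y.fn x := by
    have e : U.z = (Complex.I * (r : ℂ)) • (Ry F).fn - F.y.fn := by
      change H1Van.fnL (Rz F) = _
      rw [H1Van.fnL_apply P.hL, hzF, map_sub, map_smul]
    rw [e]
    filter_upwards [Lp.coeFn_sub ((Complex.I * (r : ℂ)) • (Ry F).fn) F.y.fn,
      Lp.coeFn_smul (Complex.I * (r : ℂ)) (Ry F).fn, hfnY] with x e1 e2 e3
    rw [e1, Pi.sub_apply, e2, Pi.smul_apply, e3, smul_eq_mul]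
  refine ⟨Rv F, Rz F, π₂.compLpL 2 (leb 0 P.L) (D F), π₄.compLpL 2 (leb 0 P.L) (D F),
    (P.τ : ℂ) • F.η - (Complex.I * (r * P.τ : ℝ)) • Rη F, w,
    (H1Van.fnL_apply P.hL _).symm, (H1Van.fnL_apply P.hL _).symm, ?_, ?_, ?_, ?_, ?_, rfl, ?_,
    rfl, ?_, ?_⟩
  · refine (isWeakDeriv_const_add_prim P.hL (π₄ X₀) (π₄.compLpL 2 (leb 0 P.L) (D F))).congr ?_
      Filter.EventuallyEq.rfl
    change (π₃.compLpL 2 (leb 0 P.L) (D F)) =ᵐ[leb 0 P.L] _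
    filter_upwards [π₃.coeFn_compLpL (D F), hDx] with x e1 e2
    rw [← hcomp π₄ F X₀ hX, e1, e2, mat_apply]
    exact add_zero _
  · exact isWeakDeriv_delay (r * P.τ) (restrictH1 P (Rv F)) ((P.τ : ℂ) • F.η)
  · exact ⟨(continuous_delayRep _ _ _).continuousOn, coeFn_delay _ _ _⟩
  · rw [hw, delayRep_zero]
    refine (fn_restrictH1 P (Rv F)).trans ?_
    change ⇑(Rv F).fn =ᵐ[_] ⇑(H1Van.fnL (Rv F))
    rw [H1Van.fnL_apply P.hL]
  · refine (isWeakDeriv_const_add_prim P.hL (π₂ X₀) (π₂.compLpL 2 (leb 0 P.L) (D F))).congr ?_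
      Filter.EventuallyEq.rfl
    have hwe : w 1 = Complex.exp (-(Complex.I * (r * P.τ : ℝ))) • restrictH1 P (Rv F)
        + endForce P r F := by
      rw [hw, delayRep_one, map_smul]; rfl
    refine (stress_ae_eq hH (S := fun x => π₂ (X x)) hvF hwe ?_).trans
      (Filter.Eventually.of_forall fun x => hcomp π₂ F X₀ hX x)
    change (π₁.compLpL 2 (leb 0 P.L) (D F)) =ᵐ[leb 0 P.L] _
    filter_upwards [π₁.coeFn_compLpL (D F), hDx] with x e1 e2
    rw [e1, e2, mat_apply]
    rfl
  · change ⇑((Complex.I * (r : ℂ)) • U.v - F.v) =ᵐ[leb 0 P.L] fun x =>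
      π₂.compLpL 2 (leb 0 P.L) (D F) x - P.c x * U.z x
    filter_upwards [Lp.coeFn_sub ((Complex.I * (r : ℂ)) • U.v) F.v,
      Lp.coeFn_smul (Complex.I * (r : ℂ)) U.v, hUv, hUz, π₂.coeFn_compLpL (D F), hDx,
      coeFn_forceS (r := r) F] with x e1 e2 e3 e4 e5 e6 e7
    have e8 : π₂ (D F x) = -(r : ℂ) ^ 2 * (X x).1 + P.c x * (Complex.I * r * (X x).2.2.1)
        + forceS P r F x := by
      rw [e6, mat_apply]; rfl
    rw [e1, Pi.sub_apply, e2, Pi.smul_apply, smul_eq_mul, e3, e4, e5, e8, e7]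
    linear_combination (r : ℂ) ^ 2 * (X x).1 * Complex.I_sq
  · change ⇑((Complex.I * (r : ℂ)) • U.z - F.z) =ᵐ[leb 0 P.L] fun x =>
      π₄.compLpL 2 (leb 0 P.L) (D F) x + P.c x * U.v x
    filter_upwards [Lp.coeFn_sub ((Complex.I * (r : ℂ)) • U.z) F.z,
      Lp.coeFn_smul (Complex.I * (r : ℂ)) U.z, hUv, hUz, π₄.coeFn_compLpL (D F), hDx,
      coeFn_forceY (r := r) F] with x e1 e2 e3 e4 e5 e6 e7
    have e8 : π₄ (D F x) = -(r : ℂ) ^ 2 * (X x).2.2.1 - P.c x * (Complex.I * r * (X x).1)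
        + forceY P r F x := by
      rw [e6, mat_apply]; rfl
    rw [e1, Pi.sub_apply, e2, Pi.smul_apply, smul_eq_mul, e3, e4, e5, e8, e7]
    linear_combination (r : ℂ) ^ 2 * (X x).2.2.1 * Complex.I_sq
  · change (Complex.I * (r : ℂ)) • Rη F - F.η =
      (-(P.τ : ℂ)⁻¹) • ((P.τ : ℂ) • F.η - (Complex.I * (r * P.τ : ℝ)) • Rη F)
    rw [smul_sub, smul_smul, smul_smul]
    have e1 : -(P.τ : ℂ)⁻¹ * P.τ = -1 := by field_simp
    have e2 : -(P.τ : ℂ)⁻¹ * (Complex.I * (r * P.τ : ℝ)) = -(Complex.I * r) := by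
      push_cast; field_simp
    rw [e1, e2]
    module

end Resolvent

/-- The imaginary axis belongs to the resolvent set of `𝒜`. -/
theorem imaginary_axis_subset_resolventSet (P : Params) (hH : P.HypH) :
    range (fun r : ℝ => Complex.I * (r : ℂ)) ⊆ resolventSet (opA P) := by
  rintro _ ⟨r, rfl⟩
  obtain ⟨R, hR⟩ := exists_resolvent hH r
  have hgraph : (opA P).graph = graphA P :=
    Submodule.toLinearPMap_graph_eq _ (graphA_single P)
  have hsol : ∀ F : State P, ∃ U : (opA P).domain,
      (U : State P) = R F ∧ (Complex.I * (r : ℂ)) • (U : State P) - opA P U = F := by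
    intro F
    have h := hR F
    rw [← hgraph, LinearPMap.mem_graph_iff] at h
    obtain ⟨U, h1, h2⟩ := h
    refine ⟨U, h1, ?_⟩
    rw [h2, h1]
    exact sub_sub_cancel _ _
  refine ⟨R, hsol, fun U => ?_⟩
  obtain ⟨V, hV, hV'⟩ := hsol ((Complex.I * (r : ℂ)) • (U : State P) - opA P U)
  -- `V - U` lies in the kernel of `ir - 𝒜`
  have hmem : (((V - U : (opA P).domain) : State P), opA P (V - U)) ∈ graphA P := by
    rw [← hgraph]; exact LinearPMap.mem_graph _ _
  have heq : opA P (V - U) = (Complex.I * (r : ℂ)) • ((V - U : (opA P).domain) : State P) := by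
    rw [LinearPMap.map_sub, Submodule.coe_sub, smul_sub]
    rw [sub_eq_sub_iff_sub_eq_sub] at hV'
    exact hV'.symm
  rw [heq] at hmem
  have h0 := eq_zero_of_mem_graphA hH hmem
  rw [Submodule.coe_sub, sub_eq_zero] at h0
  rw [← hV, h0]

end

end KelvinVoigt

theorem mainTheorem3 (P : KelvinVoigt.Params) (hH : P.HypH) :
    Set.range (fun r : ℝ => Complex.I * (r : ℂ)) ⊆
      KelvinVoigt.resolventSet (KelvinVoigt.opA P) :=
  KelvinVoigt.imaginary_axis_subset_resolventSet P hH
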